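/- Let $F$ be the distribution function of the standard normal distribution. Let $p,q\ge 1$, $k=p+q$, let $(n_i)_{i\ge1}$ be a bounded sequence of integers $n_i\ge 1$, and let $(Y_i,\mathbf X_i,\mathbf W_i)$, $i\ge 1$, be independent random elements of $\mathbb N\times\mathbb R^p\times\mathbb R^q$ on a probability space, where $\mathbf X_i=(1,X_{i2},\dots,X_{ip})'$, $\mathbf W_i=(1,W_{i2},\dots,W_{iq})'$, and the pairs $(\mathbf X_i,\mathbf W_i)$ are identically distributed. Let $\theta_0=(\beta_0',\mu_0')'\in\mathbb R^{p}\times\mathbb R^q$ and suppose that, conditionally on $(\mathbf X_i,\mathbf W_i)$, $Y_i$ is zero-inflated binomial with probit links: for every $y\in\mathbb N$, almost surely $$\mathbb P(Y_i=y\mid \mathbf X_i,\mathbf W_i)=P_{n_i}\big(y;\,\beta_0'\mathbf X_i,\mu_0'\mathbf W_i\big),\qquad P_m(y;a,b)=F(a)\mathbf 1_{\{y=0\}}+(1-F(a))\binom{m}{y}F(b)^y(1-F(b))^{m-y}.$$ For $\theta=(\beta',\mu')'$ let $l_n(\theta)=\log\prod_{i=1}^nP_{n_i}(Y_i;\beta'\mathbf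 X_i,\mu'\mathbf W_i)$ be the log-likelihood, $\dot l_n$ its gradient and $\ddot l_n$ its Hessian matrix. Let $\mathbb Z=\begin{bmatrix}\mathbb X&0\\0&\mathbb W\end{bmatrix}$ be the $k\times 2n$ matrix in which $\mathbb X$ and $\mathbb W$ have columns $\mathbf X_1,\dots,\mathbf X_n$ and $\mathbf W_1,\dots,\mathbf W_n$, and let $\mathbf D(\theta)=\begin{bmatrix}\mathbf D_1&\mathbf D_3\\\mathbf D_3&\mathbf D_2\end{bmatrix}$, where $\mathbf D_1,\mathbf D_2,\mathbf D_3$ are $n\times n$ diagonal matrices whose $i$-th diagonal entries are $-\partial_a^2$, $-\partial_b^2$ and $-\partial_a\partial_b$ of $\log P_{n_i}(Y_i;a,b)$ at $(a,b)=(\beta'\mathbf X_i,\mu'\mathbf W_i)$, so that $\ddot l_n(\theta)=-\mathbb Z\mathbf D(\theta)\mathbb Z'$. Assume: (C1) There are compact sets $G\subset\mathbb R^p$, $H\subset\mathbb R^q$ with $\mathbf X_i\in G$ and $\mathbf W_i\in H$ almost surely for every $i$; $\operatorname{var}(X_{ij})>0$ and $\operatorname{var}(W_{ij'})>0$ for all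 $i$ and all $j,j'\ge2$; for every $i$ the random variables $X_{i1},\dots,X_{ip}$ are linearly independent (no non-trivial linear combination vanishes almost surely), and so are $W_{i1},\dots,W_{iq}$. (C2) $\beta_0$ and $\mu_0$ lie in the interior of compact subsets of $\mathbb R^p$ and $\mathbb R^q$, respectively. (C3) There is a constant $0<c_2<\infty$ such that, almost surely, for all sufficiently large $n$, $\ddot l_n(\theta_0)$ is negative definite and $\Lambda_n/\lambda_n<c_2$, where $\lambda_n$ and $\Lambda_n$ are the smallest and the largest eigenvalue of $\mathbb Z\mathbf D(\theta_0)\mathbb Z'$. Let $\widehat\theta_n$, $n\ge1$, be random vectors in $\mathbb R^k$ such that, almost surely, $\dot l_n(\widehat\theta_n)=0$ for all sufficiently large $n$ (maximum likelihood estimators, in the sense of the score equation), and suppose that $\widehat\theta_n\to\theta_0$ almost surely. Let $\widehat\Sigma_n=\mathbb Z\mathbf D(\widehat\theta_n)\mathbb Z'$ be the observed information matrix and $\widehat\Sigma_n^{1/2}$ its positive semidefinite square root (set to $0$ when $\widehat\Sigma_n$ is not positive semidefinite). Then, as $n\to\infty$, $$\widehat\Sigma_n^{1/2}(\widehat\theta_n-\theta_0)\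 \longrightarrow\ \mathcal N(0,I_k)\quad\text{in distribution.}$$ -/

import Mathlib

open MeasureTheory ProbabilityTheory Filter Topology
open scoped MatrixOrder

noncomputable section

namespace ProbitZIB

/-- The cumulative distribution function of the standard normal distribution. -/
def stdNormalCDF (t : ℝ) : ℝ := cdf (gaussianReal 0 1) t

/-- Probability of the value `y` under the zero-inflated binomial distribution: a structural zero
with probability `zeroProb`, and a binomial variable with `m` trials and success probability
`succProb` with probability `1 - zeroProb`. -/
def zibProb (m : ℕ) (zeroProb succProb : ℝ) (y : ℕ) : ℝ :=
  (if y = 0 then zeroProb else 0)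
    + (1 - zeroProb) * ((m.choose y : ℝ) * succProb ^ y * (1 - succProb) ^ (m - y))

/-- The parameter space: `θ = (β, μ)` with `β ∈ ℝ^p` and `μ ∈ ℝ^q`, Euclidean norm. -/
abbrev Param (p q : ℕ) : Type := EuclideanSpace ℝ (Fin p ⊕ Fin q)

variable {p q : ℕ}

/-- The component `β` of `θ = (β, μ)`. -/
def betaPart (θ : Param p q) : EuclideanSpace ℝ (Fin p) := WithLp.toLp 2 fun j => θ (Sum.inl j)

/-- The component `μ` of `θ = (β, μ)`. -/
def muPart (θ : Param p q) : EuclideanSpace ℝ (Fin q) := WithLp.toLp 2 fun j => θ (Sum.inr j)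

/-- The linear predictor `β' x` of the zero-inflation component. -/
def zeroPredictor (θ : Param p q) (x : EuclideanSpace ℝ (Fin p)) : ℝ := ∑ j, betaPart θ j * x j

/-- The linear predictor `μ' w` of the binomial component. -/
def binomPredictor (θ : Param p q) (w : EuclideanSpace ℝ (Fin q)) : ℝ := ∑ j, muPart θ j * w j

/-- The conditional probability of the response `y` out of `m` trials given the covariates `x`
and `w`, in the model with probit links and parameter `θ`. -/
def modelProb (m : ℕ) (θ : Param p q) (x : EuclideanSpace ℝ (Fin p))
    (w : EuclideanSpace ℝ (Fin q)) (y : ℕ) : ℝ :=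
  zibProb m (stdNormalCDF (zeroPredictor θ x)) (stdNormalCDF (binomPredictor θ w)) y

/-! In what follows `m`, `y`, `x`, `w` are the sequences of trial numbers, responses and
covariates; a sample of size `n` consists of the indices `i < n`. -/

/-- The likelihood of a sample of size `n`. -/
def likelihood (m y : ℕ → ℕ) (x : ℕ → EuclideanSpace ℝ (Fin p)) (w : ℕ → EuclideanSpace ℝ (Fin q))
    (n : ℕ) (θ : Param p q) : ℝ :=
  ∏ i : Fin n, modelProb (m i) θ (x i) (w i) (y i)

/-- The log-likelihood of a sample of size `n`. -/
def logLikelihood (m y : ℕ → ℕ) (x : ℕ → EuclideanSpace ℝ (Fin p))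
    (w : ℕ → EuclideanSpace ℝ (Fin q)) (n : ℕ) (θ : Param p q) : ℝ :=
  Real.log (likelihood m y x w n θ)

/-- The score: the gradient of the log-likelihood. -/
def score (m y : ℕ → ℕ) (x : ℕ → EuclideanSpace ℝ (Fin p)) (w : ℕ → EuclideanSpace ℝ (Fin q))
    (n : ℕ) (θ : Param p q) : Param p q :=
  gradient (logLikelihood m y x w n) θ

/-- The Hessian matrix of the log-likelihood. -/
def hessian (m y : ℕ → ℕ) (x : ℕ → EuclideanSpace ℝ (Fin p)) (w : ℕ → EuclideanSpace ℝ (Fin q))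
    (n : ℕ) (θ : Param p q) : Matrix (Fin p ⊕ Fin q) (Fin p ⊕ Fin q) ℝ :=
  Matrix.of fun a b => iteratedFDeriv ℝ 2 (logLikelihood m y x w n) θ
    ![EuclideanSpace.single a 1, EuclideanSpace.single b 1]

/-- The log-likelihood contribution of one observation `y` out of `m` trials, as a function of
the values `a = β' x` and `b = μ' w` of the two linear predictors. -/
def obsLogLik (m y : ℕ) (a b : ℝ) : ℝ := Real.log (zibProb m (stdNormalCDF a) (stdNormalCDF b) y)

/-- The block matrix `ℤ = [𝕏, 0; 0, 𝕎]`, of size `(p + q) × 2n`; column `i` of `𝕏`, `𝕎` is the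
covariate vector of observation `i`. -/
def designMatrix (x : ℕ → EuclideanSpace ℝ (Fin p)) (w : ℕ → EuclideanSpace ℝ (Fin q)) (n : ℕ) :
    Matrix (Fin p ⊕ Fin q) (Fin n ⊕ Fin n) ℝ :=
  Matrix.fromBlocks (Matrix.of fun j i => x i j) 0 0 (Matrix.of fun j i => w i j)

/-- The block matrix `D(θ) = [D₁, D₃; D₃, D₂]`, of size `2n × 2n`, with diagonal blocks: the
`i`-th diagonal entries of `D₁`, `D₂`, `D₃` are minus the second derivatives `∂²/∂a²`, `∂²/∂b²`,
`∂²/∂a∂b` of the `i`-th log-likelihood contribution, at `a = β' xᵢ`, `b = μ' wᵢ`. Thus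
`ℤ D(θ) ℤ'` is minus the Hessian of the log-likelihood. -/
def weightMatrix (m y : ℕ → ℕ) (x : ℕ → EuclideanSpace ℝ (Fin p))
    (w : ℕ → EuclideanSpace ℝ (Fin q)) (n : ℕ) (θ : Param p q) :
    Matrix (Fin n ⊕ Fin n) (Fin n ⊕ Fin n) ℝ :=
  let D₁ : Fin n → ℝ := fun i =>
    -iteratedDeriv 2 (fun a => obsLogLik (m i) (y i) a (binomPredictor θ (w i)))
      (zeroPredictor θ (x i))
  let D₂ : Fin n → ℝ := fun i =>
    -iteratedDeriv 2 (fun b => obsLogLik (m i) (y i) (zeroPredictor θ (x i)) b)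
      (binomPredictor θ (w i))
  let D₃ : Fin n → ℝ := fun i =>
    -deriv (fun a => deriv (fun b => obsLogLik (m i) (y i) a b) (binomPredictor θ (w i)))
      (zeroPredictor θ (x i))
  Matrix.fromBlocks (Matrix.diagonal D₁) (Matrix.diagonal D₃)
    (Matrix.diagonal D₃) (Matrix.diagonal D₂)

/-- The observed information matrix `Σ_n(θ) = ℤ D(θ) ℤ'`. -/
def observedInfo (m y : ℕ → ℕ) (x : ℕ → EuclideanSpace ℝ (Fin p))
    (w : ℕ → EuclideanSpace ℝ (Fin q)) (n : ℕ) (θ : Param p q) :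
    Matrix (Fin p ⊕ Fin q) (Fin p ⊕ Fin q) ℝ :=
  designMatrix x w n * weightMatrix m y x w n θ * (designMatrix x w n).transpose

/-- The smallest eigenvalue of a (real symmetric) matrix. -/
def minEigenvalue {ι : Type*} [Fintype ι] [DecidableEq ι] (M : Matrix ι ι ℝ) : ℝ :=
  sInf (spectrum ℝ M)

/-- The largest eigenvalue of a (real symmetric) matrix. -/
def maxEigenvalue {ι : Type*} [Fintype ι] [DecidableEq ι] (M : Matrix ι ι ℝ) : ℝ :=
  sSup (spectrum ℝ M)

variable {Ω : Type*} [MeasurableSpace Ω]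

/-- `(Yᵢ, Xᵢ, Wᵢ)`, `i = 0, 1, …`, are independent observations from the zero-inflated binomial
regression model with probit links, trial numbers `mᵢ` and true parameter `θ₀`, with identically
distributed covariates whose first coordinates are the constant `1`. -/
structure IsSample [NeZero p] [NeZero q] (P : Measure Ω) (m : ℕ → ℕ) (Y : ℕ → Ω → ℕ)
    (X : ℕ → Ω → EuclideanSpace ℝ (Fin p)) (W : ℕ → Ω → EuclideanSpace ℝ (Fin q))
    (θ₀ : Param p q) : Prop where
  measurable_Y : ∀ i, Measurable (Y i)
  measurable_X : ∀ i, Measurable (X i)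
  measurable_W : ∀ i, Measurable (W i)
  intercept_X : ∀ i ω, X i ω 0 = 1
  intercept_W : ∀ i ω, W i ω 0 = 1
  indep : iIndepFun (fun i ω => (Y i ω, X i ω, W i ω)) P
  identDistrib : ∀ i, IdentDistrib (fun ω => (X i ω, W i ω)) (fun ω => (X 0 ω, W 0 ω)) P P
  trials_pos : ∀ i, 1 ≤ m i
  trials_bdd : ∃ M, ∀ i, m i ≤ M
  condProb : ∀ i y,
    P⟦Y i ⁻¹' {y} | MeasurableSpace.comap (fun ω => (X i ω, W i ω)) inferInstance⟧
      =ᵐ[P] fun ω => modelProb (m i) θ₀ (X i ω) (W i ω) y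

/-- Random covariate vectors `Vᵢ` in `ℝ^r` that are bounded uniformly in `i`, with non-constant
coordinates (apart from the intercept) and with linearly independent coordinates. -/
structure RegularCovariates {r : ℕ} [NeZero r] (P : Measure Ω)
    (V : ℕ → Ω → EuclideanSpace ℝ (Fin r)) : Prop where
  bounded : ∃ K : Set (EuclideanSpace ℝ (Fin r)), IsCompact K ∧ ∀ i, ∀ᵐ ω ∂P, V i ω ∈ K
  variance_pos : ∀ i, ∀ j : Fin r, j ≠ 0 → 0 < Var[fun ω => V i ω j; P]
  linearIndep : ∀ i, ∀ u : Fin r → ℝ, (∀ᵐ ω ∂P, ∑ j, u j * V i ω j = 0) → u = 0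

/-- The two components of the true parameter lie in the interior of compact sets. -/
def InteriorParam (θ₀ : Param p q) : Prop :=
  (∃ 𝒢 : Set (EuclideanSpace ℝ (Fin p)), IsCompact 𝒢 ∧ betaPart θ₀ ∈ interior 𝒢) ∧
  (∃ ℋ : Set (EuclideanSpace ℝ (Fin q)), IsCompact ℋ ∧ muPart θ₀ ∈ interior ℋ)

/-- Almost surely, for all large `n`, the Hessian of the log-likelihood at `θ₀` is negative
definite and the condition number of `ℤ D(θ₀) ℤ'` is less than a constant `c₂`. -/
def WellConditioned (P : Measure Ω) (m : ℕ → ℕ) (Y : ℕ → Ω → ℕ)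
    (X : ℕ → Ω → EuclideanSpace ℝ (Fin p)) (W : ℕ → Ω → EuclideanSpace ℝ (Fin q))
    (θ₀ : Param p q) : Prop :=
  ∃ c₂ : ℝ, 0 < c₂ ∧ ∀ᵐ ω ∂P, ∀ᶠ n in atTop,
    (-hessian m (Y · ω) (X · ω) (W · ω) n θ₀).PosDef ∧
    maxEigenvalue (observedInfo m (Y · ω) (X · ω) (W · ω) n θ₀) /
      minEigenvalue (observedInfo m (Y · ω) (X · ω) (W · ω) n θ₀) < c₂

/-- `θhat n` is a maximum likelihood estimator in the sense of the score equation: random vectors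
that, almost surely, solve the score equation for all large `n`. -/
structure IsScoreEstimator (P : Measure Ω) (m : ℕ → ℕ) (Y : ℕ → Ω → ℕ)
    (X : ℕ → Ω → EuclideanSpace ℝ (Fin p)) (W : ℕ → Ω → EuclideanSpace ℝ (Fin q))
    (θhat : ℕ → Ω → Param p q) : Prop where
  measurable : ∀ n, Measurable (θhat n)
  score_eq_zero : ∀ᵐ ω ∂P, ∀ᶠ n in atTop, score m (Y · ω) (X · ω) (W · ω) n (θhat n ω) = 0

/-- The normalized estimator `Σ̂_n^{1/2} (θ̂_n - θ₀)`, where `Σ̂_n = ℤ D(θ̂_n) ℤ'` and the square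
root is the positive semidefinite one (it is `0` by convention if `Σ̂_n` is not positive
semidefinite). -/
def normalizedEstimator (m : ℕ → ℕ) (Y : ℕ → Ω → ℕ)
    (X : ℕ → Ω → EuclideanSpace ℝ (Fin p)) (W : ℕ → Ω → EuclideanSpace ℝ (Fin q))
    (θ₀ : Param p q) (θhat : ℕ → Ω → Param p q) (n : ℕ) (ω : Ω) : Param p q :=
  Matrix.toEuclideanCLM (𝕜 := ℝ)
    (CFC.sqrt (observedInfo m (Y · ω) (X · ω) (W · ω) n (θhat n ω))) (θhat n ω - θ₀)

end ProbitZIB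

end

/-
Expand the score around `θ₀`. Since `θ̂_n` is a root of the score and `θ̂_n → θ₀`, the score at `θ₀`
is `Σ̂_n (θ̂_n - θ₀)` up to an error `o(n) ‖θ̂_n - θ₀‖`. The score at `θ₀` is a sum of bounded
independent centred vectors with covariance `V_n = 𝔼 Σ_n(θ₀)` (Bartlett's identities), so
`V_n^{-1/2}` times it is asymptotically standard normal as soon as `V_n ≥ c n` for some `c > 0`.
In the direction of the intercept of the zero-inflation component, each observation contributes a
positive amount bounded away from zero, whence `Λ_n` grows linearly; by (C3) so does `λ_n`, and
`Σ_n(θ₀) = V_n + o_P(n)` passes this on to `V_n`. Finally `A ↦ A^{1/2}` is Hölder continuous with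
exponent 1/2 on positive semidefinite matrices, so that `Σ̂_n = V_n + o_P(n)` allows `V_n^{1/2}` to
be replaced by `Σ̂_n^{1/2}` in the limit.
-/

noncomputable section

namespace ProbitZIB

open Matrix
open scoped RealInnerProductSpace Matrix.Norms.L2Operator

local notation "𝓛" => Matrix.toEuclideanCLM (𝕜 := ℝ)

variable {p q : ℕ}

section Matrices

lemma isClosed_posSemidef {ι : Type*} [Finite ι] : IsClosed {A : Matrix ι ι ℝ | A.PosSemidef} := by
  have := Fintype.ofFinite ι
  simp only [posSemidef_iff_dotProduct_mulVec, Set.ofPred_and, Set.ofPred_forall]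
  exact (isClosed_eq (by fun_prop) continuous_id).inter
    (isClosed_iInter fun x => isClosed_le continuous_const (by fun_prop))

variable {ι : Type*} [Fintype ι] [DecidableEq ι] {A B M V : Matrix ι ι ℝ}

lemma norm_toEuclideanCLM_apply_le (M : Matrix ι ι ℝ) (x : EuclideanSpace ℝ ι) :
    ‖𝓛 M x‖ ≤ ‖M‖ * ‖x‖ :=
  (𝓛 M).le_opNorm x

lemma abs_inner_toEuclideanCLM_le (M : Matrix ι ι ℝ) (x : EuclideanSpace ℝ ι) :
    |⟪x, 𝓛 M x⟫| ≤ ‖M‖ * ‖x‖ ^ 2 :=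
  calc |⟪x, 𝓛 M x⟫| ≤ ‖x‖ * (‖M‖ * ‖x‖) :=
        (abs_real_inner_le_norm _ _).trans (by gcongr; exact norm_toEuclideanCLM_apply_le M x)
    _ = ‖M‖ * ‖x‖ ^ 2 := by ring

lemma toEuclideanCLM_sub_apply (A B : Matrix ι ι ℝ) (x : EuclideanSpace ℝ ι) :
    𝓛 (A - B) x = 𝓛 A x - 𝓛 B x := by
  rw [map_sub, _root_.sub_apply]

lemma abs_inner_sub_inner_toEuclideanCLM_le (A B : Matrix ι ι ℝ) (x : EuclideanSpace ℝ ι) :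
    |⟪x, 𝓛 A x⟫ - ⟪x, 𝓛 B x⟫| ≤ ‖A - B‖ * ‖x‖ ^ 2 := by
  rw [← inner_sub_right, ← toEuclideanCLM_sub_apply]
  exact abs_inner_toEuclideanCLM_le _ _

lemma abs_apply_le_l2_opNorm (M : Matrix ι ι ℝ) (a b : ι) : |M a b| ≤ ‖M‖ := by
  have hab : M a b = 𝓛 M (EuclideanSpace.single b 1) a := by
    rw [ofLp_toEuclideanCLM]; simp
  calc |M a b| ≤ ‖𝓛 M (EuclideanSpace.single b 1)‖ := by
        rw [hab, ← Real.norm_eq_abs]; exact PiLp.norm_apply_le _ _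
    _ ≤ ‖M‖ := by simpa using norm_toEuclideanCLM_apply_le M (EuclideanSpace.single b 1)

lemma l2_opNorm_single_one (a b : ι) : ‖single a b (1 : ℝ)‖ = 1 := by
  have hsq : ‖single a b (1 : ℝ)‖ * ‖single a b (1 : ℝ)‖ = 1 := by
    rw [← l2_opNorm_conjTranspose_mul_self, conjTranspose_single, single_mul_single_same,
      ← diagonal_single, l2_opNorm_diagonal, Pi.norm_single]
    simp
  nlinarith [norm_nonneg (single a b (1 : ℝ))]

lemma l2_opNorm_le_sum (M : Matrix ι ι ℝ) : ‖M‖ ≤ ∑ a, ∑ b, |M a b| := by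
  conv_lhs => rw [matrix_eq_sum_single M]
  refine (norm_sum_le _ _).trans (Finset.sum_le_sum fun a _ => ?_)
  refine (norm_sum_le _ _).trans (Finset.sum_le_sum fun b _ => ?_)
  rw [← mul_one (M a b), ← smul_eq_mul, ← smul_single, norm_smul, l2_opNorm_single_one,
    Real.norm_eq_abs, smul_eq_mul, mul_one, mul_one]

lemma inner_toEuclideanCLM_comm (hM : M.IsHermitian) (x y : EuclideanSpace ℝ ι) :
    ⟪𝓛 M x, y⟫ = ⟪x, 𝓛 M y⟫ :=
  isSymmetric_toEuclideanLin_iff.2 hM x y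

lemma posSemidef_iff_inner :
    M.PosSemidef ↔ M.IsHermitian ∧ ∀ x : EuclideanSpace ℝ ι, 0 ≤ ⟪x, 𝓛 M x⟫ := by
  simp only [posSemidef_iff_dotProduct_mulVec, inner_toEuclideanCLM, star_trivial]
  exact and_congr_right fun _ => (WithLp.equiv 2 (ι → ℝ)).symm.forall_congr_left

lemma posDef_of_le_inner (hM : M.IsHermitian) {c : ℝ} (hc : 0 < c)
    (h : ∀ x : EuclideanSpace ℝ ι, c * ‖x‖ ^ 2 ≤ ⟪x, 𝓛 M x⟫) : M.PosDef := by
  refine posDef_iff_dotProduct_mulVec.2 ⟨hM, fun x hx => ?_⟩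
  have hx' : 0 < ‖WithLp.toLp 2 x‖ := norm_pos_iff.2 (by simpa using hx)
  rw [star_trivial]
  calc 0 < c * ‖WithLp.toLp 2 x‖ ^ 2 := by positivity
    _ ≤ x ⬝ᵥ M *ᵥ x := (h _).trans_eq (inner_toEuclideanCLM M _ _)

lemma posSemidef_of_norm_sub_le (hA : A.IsHermitian) {c : ℝ}
    (hV : ∀ x : EuclideanSpace ℝ ι, c * ‖x‖ ^ 2 ≤ ⟪x, 𝓛 V x⟫) (hAV : ‖A - V‖ ≤ c) :
    A.PosSemidef := by
  refine posSemidef_iff_inner.2 ⟨hA, fun x => ?_⟩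
  have hdist := (abs_le.1 (abs_inner_sub_inner_toEuclideanCLM_le A V x)).1
  have hcoef : ‖A - V‖ * ‖x‖ ^ 2 ≤ c * ‖x‖ ^ 2 := by gcongr
  linarith [hV x]

lemma mul_norm_le_norm_toEuclideanCLM {c : ℝ} {x : EuclideanSpace ℝ ι}
    (h : c * ‖x‖ ^ 2 ≤ ⟪x, 𝓛 M x⟫) : c * ‖x‖ ≤ ‖𝓛 M x‖ := by
  rcases (norm_nonneg x).eq_or_lt with hx | hx
  · rw [← hx, mul_zero]; exact norm_nonneg _
  · refine le_of_mul_le_mul_left ?_ hx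
    calc ‖x‖ * (c * ‖x‖) = c * ‖x‖ ^ 2 := by ring
      _ ≤ ‖x‖ * ‖𝓛 M x‖ := h.trans (real_inner_le_norm _ _)

lemma toEuclideanCLM_eigenvectorBasis (hM : M.IsHermitian) (j : ι) :
    𝓛 M (hM.eigenvectorBasis j) = hM.eigenvalues j • hM.eigenvectorBasis j := by
  apply WithLp.ofLp_injective 2
  rw [ofLp_toEuclideanCLM, hM.mulVec_eigenvectorBasis, WithLp.ofLp_smul]

lemma inner_eigenvectorBasis_toEuclideanCLM (hM : M.IsHermitian) (j : ι)
    (x : EuclideanSpace ℝ ι) :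
    ⟪hM.eigenvectorBasis j, 𝓛 M x⟫ = hM.eigenvalues j * ⟪hM.eigenvectorBasis j, x⟫ := by
  rw [← inner_toEuclideanCLM_comm hM, toEuclideanCLM_eigenvectorBasis, real_inner_smul_left]

lemma inner_toEuclideanCLM_eq_sum_eigenvalues (hM : M.IsHermitian) (x : EuclideanSpace ℝ ι) :
    ⟪x, 𝓛 M x⟫ = ∑ j, hM.eigenvalues j * ⟪hM.eigenvectorBasis j, x⟫ ^ 2 := by
  rw [← hM.eigenvectorBasis.sum_inner_mul_inner]
  refine Finset.sum_congr rfl fun j _ => ?_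
  rw [inner_eigenvectorBasis_toEuclideanCLM, real_inner_comm x]
  ring

lemma l2_opNorm_le_of_abs_eigenvalues_le (hM : M.IsHermitian) {C : ℝ} (hC : 0 ≤ C)
    (h : ∀ j, |hM.eigenvalues j| ≤ C) : ‖M‖ ≤ C := by
  refine ContinuousLinearMap.opNorm_le_bound (𝓛 M) hC fun x => ?_
  rw [← sq_le_sq₀ (norm_nonneg _) (by positivity), mul_pow,
    ← hM.eigenvectorBasis.sum_sq_norm_inner_right, ← hM.eigenvectorBasis.sum_sq_norm_inner_right x,
    Finset.mul_sum]
  refine Finset.sum_le_sum fun j _ => ?_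
  rw [inner_eigenvectorBasis_toEuclideanCLM, norm_mul, mul_pow]
  gcongr
  exact h j

lemma minEigenvalue_mul_norm_sq_le_inner (hM : M.IsHermitian) (x : EuclideanSpace ℝ ι) :
    minEigenvalue M * ‖x‖ ^ 2 ≤ ⟪x, 𝓛 M x⟫ := by
  rw [inner_toEuclideanCLM_eq_sum_eigenvalues hM, ← hM.eigenvectorBasis.sum_sq_norm_inner_right x,
    Finset.mul_sum]
  refine Finset.sum_le_sum fun j _ => ?_
  rw [Real.norm_eq_abs, sq_abs]
  gcongr
  exact csInf_le (finite_real_spectrum (A := M)).bddBelow (hM.eigenvalues_mem_spectrum_real j)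

lemma inner_le_maxEigenvalue_mul_norm_sq (hM : M.IsHermitian) (x : EuclideanSpace ℝ ι) :
    ⟪x, 𝓛 M x⟫ ≤ maxEigenvalue M * ‖x‖ ^ 2 := by
  rw [inner_toEuclideanCLM_eq_sum_eigenvalues hM, ← hM.eigenvectorBasis.sum_sq_norm_inner_right x,
    Finset.mul_sum]
  refine Finset.sum_le_sum fun j _ => ?_
  rw [Real.norm_eq_abs, sq_abs]
  gcongr
  exact le_csSup (finite_real_spectrum (A := M)).bddAbove (hM.eigenvalues_mem_spectrum_real j)

lemma minEigenvalue_pos [Nonempty ι] (hM : M.PosDef) : 0 < minEigenvalue M := by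
  rw [minEigenvalue, hM.1.spectrum_real_eq_range_eigenvalues]
  obtain ⟨j, hj⟩ := (Set.range_nonempty hM.1.eigenvalues).csInf_mem (Set.finite_range _)
  exact hj ▸ hM.eigenvalues_pos j

/-- A lower bound for `V` in the single direction `e` bounds `maxEigenvalue A` from below, hence
`minEigenvalue A`, hence `V` in every direction. -/
lemma le_inner_of_maxEigenvalue_div_minEigenvalue_lt [Nonempty ι] (hA : A.PosDef) {κ c₂ : ℝ}
    (hκ : 0 < κ) (hc₂ : 0 < c₂) (hcond : maxEigenvalue A / minEigenvalue A < c₂)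
    {e : EuclideanSpace ℝ ι} (he : ‖e‖ = 1) (hVe : κ ≤ ⟪e, 𝓛 V e⟫)
    (hAV : ‖A - V‖ ≤ min (κ / 2) (κ / (4 * c₂))) (x : EuclideanSpace ℝ ι) :
    κ / (4 * c₂) * ‖x‖ ^ 2 ≤ ⟪x, 𝓛 V x⟫ := by
  have hmax : κ / 2 ≤ maxEigenvalue A := by
    have hAe := inner_le_maxEigenvalue_mul_norm_sq hA.1 e
    have hdist := (abs_le.1 (abs_inner_sub_inner_toEuclideanCLM_le A V e)).1
    rw [he] at hAe hdist
    linarith [hAV.trans (min_le_left _ _)]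
  have hmin : κ / (2 * c₂) ≤ minEigenvalue A := by
    rw [← div_div, div_le_iff₀' hc₂]
    exact hmax.trans ((div_lt_iff₀ (minEigenvalue_pos hA)).1 hcond).le
  have hdist := (abs_le.1 (abs_inner_sub_inner_toEuclideanCLM_le A V x)).2
  have hhalf : κ / (2 * c₂) - κ / (4 * c₂) = κ / (4 * c₂) := by field_simp; norm_num
  calc κ / (4 * c₂) * ‖x‖ ^ 2 = κ / (2 * c₂) * ‖x‖ ^ 2 - κ / (4 * c₂) * ‖x‖ ^ 2 := by
        rw [← sub_mul, hhalf]
    _ ≤ minEigenvalue A * ‖x‖ ^ 2 - ‖A - V‖ * ‖x‖ ^ 2 := by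
        gcongr
        exact hAV.trans (min_le_right _ _)
    _ ≤ ⟪x, 𝓛 V x⟫ := by linarith [minEigenvalue_mul_norm_sq_le_inner hA.1 x]

lemma toEuclideanCLM_sqrt_sqrt_apply (hA : A.PosSemidef) (x : EuclideanSpace ℝ ι) :
    𝓛 (CFC.sqrt A) (𝓛 (CFC.sqrt A) x) = 𝓛 A x := by
  conv_rhs => rw [← CFC.sqrt_mul_sqrt_self A hA.nonneg, map_mul]
  rfl

lemma norm_toEuclideanCLM_sqrt_sq (hA : A.PosSemidef) (x : EuclideanSpace ℝ ι) :
    ‖𝓛 (CFC.sqrt A) x‖ ^ 2 = ⟪x, 𝓛 A x⟫ := by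
  rw [← real_inner_self_eq_norm_sq, inner_toEuclideanCLM_comm (CFC.sqrt_nonneg A).posSemidef.1,
    toEuclideanCLM_sqrt_sqrt_apply hA]

lemma norm_toEuclideanCLM_sqrt_le (hA : A.PosSemidef) (x : EuclideanSpace ℝ ι) :
    ‖𝓛 (CFC.sqrt A) x‖ ≤ √‖A‖ * ‖x‖ := by
  rw [← sq_le_sq₀ (norm_nonneg _) (by positivity), norm_toEuclideanCLM_sqrt_sq hA, mul_pow,
    Real.sq_sqrt (norm_nonneg _)]
  exact (le_abs_self _).trans (abs_inner_toEuclideanCLM_le A x)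

lemma sqrt_mul_norm_le_norm_toEuclideanCLM_sqrt (hA : A.PosSemidef) {c : ℝ} (hc : 0 ≤ c)
    {x : EuclideanSpace ℝ ι} (h : c * ‖x‖ ^ 2 ≤ ⟪x, 𝓛 A x⟫) :
    √c * ‖x‖ ≤ ‖𝓛 (CFC.sqrt A) x‖ := by
  rwa [← sq_le_sq₀ (by positivity) (norm_nonneg _), norm_toEuclideanCLM_sqrt_sq hA, mul_pow,
    Real.sq_sqrt hc]

lemma toEuclideanCLM_sqrt_inv_apply (hA : A.PosDef) (x : EuclideanSpace ℝ ι) :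
    𝓛 (CFC.sqrt A) (𝓛 (CFC.sqrt A)⁻¹ x) = x := by
  have hdet : IsUnit (CFC.sqrt A).det := by
    refine isUnit_of_mul_isUnit_left (y := (CFC.sqrt A).det) ?_
    rw [← det_mul, CFC.sqrt_mul_sqrt_self A hA.posSemidef.nonneg]
    exact hA.det_pos.ne'.isUnit
  rw [← mul_apply_eq_comp, ← map_mul, mul_nonsing_inv _ hdet, map_one,
    one_apply_eq_self]

/-- For a unit eigenvector `e` of `√A - √B` with eigenvalue `l`, one has
`⟪e, (A - B) e⟫ = ‖√A e‖ ^ 2 - ‖√B e‖ ^ 2 = l * (⟪e, √A e⟫ + ⟪e, √B e⟫)`, and the last factor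
is at least `|l|`. -/
lemma norm_sqrt_sub_sqrt_sq_le (hA : A.PosSemidef) (hB : B.PosSemidef) :
    ‖CFC.sqrt A - CFC.sqrt B‖ ^ 2 ≤ ‖A - B‖ := by
  have hRA := posSemidef_iff_inner.1 (CFC.sqrt_nonneg A).posSemidef
  have hRB := posSemidef_iff_inner.1 (CFC.sqrt_nonneg B).posSemidef
  have hS : (CFC.sqrt A - CFC.sqrt B).IsHermitian := hRA.1.sub hRB.1
  refine (Real.le_sqrt (norm_nonneg _) (norm_nonneg _)).1
    (l2_opNorm_le_of_abs_eigenvalues_le hS (Real.sqrt_nonneg _) fun j => Real.abs_le_sqrt ?_)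
  set e := hS.eigenvectorBasis j
  set l := hS.eigenvalues j
  have he : ‖e‖ = 1 := hS.eigenvectorBasis.norm_eq_one j
  have hAe : 𝓛 (CFC.sqrt A) e = 𝓛 (CFC.sqrt B) e + l • e := by
    rw [← toEuclideanCLM_eigenvectorBasis hS j, toEuclideanCLM_sub_apply, add_sub_cancel]
  have hl : ⟪e, 𝓛 (CFC.sqrt A) e⟫ = ⟪e, 𝓛 (CFC.sqrt B) e⟫ + l := by
    rw [hAe, inner_add_right, real_inner_smul_right, real_inner_self_eq_norm_sq, he]; ring
  have hdiff : ⟪e, 𝓛 A e⟫ - ⟪e, 𝓛 B e⟫ =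
      l * (⟪e, 𝓛 (CFC.sqrt A) e⟫ + ⟪e, 𝓛 (CFC.sqrt B) e⟫) := by
    rw [← norm_toEuclideanCLM_sqrt_sq hA, ← norm_toEuclideanCLM_sqrt_sq hB, hl, hAe,
      norm_add_sq_real, real_inner_smul_right, norm_smul, he, real_inner_comm, Real.norm_eq_abs,
      mul_one, sq_abs]
    ring
  have hnonneg := add_nonneg (hRA.2 e) (hRB.2 e)
  have hle : |l| ≤ ⟪e, 𝓛 (CFC.sqrt A) e⟫ + ⟪e, 𝓛 (CFC.sqrt B) e⟫ :=
    abs_le.2 ⟨by linarith [hRA.2 e], by linarith [hRB.2 e]⟩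
  calc l ^ 2 = |l| * |l| := by rw [← sq, sq_abs]
    _ ≤ |l| * (⟪e, 𝓛 (CFC.sqrt A) e⟫ + ⟪e, 𝓛 (CFC.sqrt B) e⟫) := by gcongr
    _ = |⟪e, 𝓛 A e⟫ - ⟪e, 𝓛 B e⟫| := by rw [hdiff, abs_mul, abs_of_nonneg hnonneg]
    _ ≤ ‖A - B‖ := by simpa [he] using abs_inner_sub_inner_toEuclideanCLM_le A B e

lemma continuousOn_sqrt_posSemidef :
    ContinuousOn (CFC.sqrt : Matrix ι ι ℝ → Matrix ι ι ℝ) {A | A.PosSemidef} := by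
  intro A hA
  rw [ContinuousWithinAt, tendsto_iff_norm_sub_tendsto_zero]
  have hlim : Tendsto (fun B : Matrix ι ι ℝ => √‖B - A‖) (𝓝[{A | A.PosSemidef}] A) (𝓝 0) := by
    have hcont : Continuous fun B : Matrix ι ι ℝ => √‖B - A‖ := by fun_prop
    simpa using (hcont.tendsto A).mono_left nhdsWithin_le_nhds
  refine squeeze_zero' (Eventually.of_forall fun _ => norm_nonneg _) ?_ hlim
  filter_upwards [self_mem_nhdsWithin] with B hB
  exact Real.le_sqrt_of_sq_le (norm_sqrt_sub_sqrt_sq_le hB hA)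

/-- The error is controlled through `√V (√A h - z) = (√V - √A) (√A h) - (s - A h)`. -/
lemma norm_sqrt_apply_sub_le (hA : A.PosSemidef) (hV : V.PosSemidef) {c C ε : ℝ} (hc : 0 < c)
    (hε : ε ≤ c / 4) (hV_low : ∀ u : EuclideanSpace ℝ ι, c * ‖u‖ ^ 2 ≤ ⟪u, 𝓛 V u⟫)
    (hAC : ‖A‖ ≤ C) (hAV : ‖A - V‖ ≤ ε) {h s z : EuclideanSpace ℝ ι}
    (hz : 𝓛 (CFC.sqrt V) z = s) (hs : ‖s - 𝓛 A h‖ ≤ ε * ‖h‖) :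
    ‖𝓛 (CFC.sqrt A) h - z‖ ≤ 2 / (c * √c) * (√(ε * C) + ε) * ‖s‖ := by
  have hε₀ : 0 ≤ ε := (norm_nonneg _).trans hAV
  have hVA : ‖V - A‖ ≤ ε := by rwa [norm_sub_rev]
  have hh : ‖h‖ ≤ 2 / c * ‖s‖ := by
    have hVh : 𝓛 V h = 𝓛 (V - A) h - (s - 𝓛 A h) + s := by
      rw [toEuclideanCLM_sub_apply]; abel
    have hchain : c * ‖h‖ ≤ 2 * (c / 4) * ‖h‖ + ‖s‖ :=
      calc c * ‖h‖ ≤ ‖𝓛 (V - A) h - (s - 𝓛 A h) + s‖ :=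
            hVh ▸ mul_norm_le_norm_toEuclideanCLM (hV_low h)
        _ ≤ ε * ‖h‖ + ε * ‖h‖ + ‖s‖ := by
            refine (norm_add_le _ _).trans (add_le_add_left ((norm_sub_le _ _).trans ?_) _)
            exact add_le_add ((norm_toEuclideanCLM_apply_le _ _).trans (by gcongr)) hs
        _ ≤ 2 * (c / 4) * ‖h‖ + ‖s‖ := by rw [← two_mul, ← mul_assoc]; gcongr
    rw [div_mul_eq_mul_div, le_div_iff₀ hc]
    linarith
  set D := 𝓛 (CFC.sqrt A) h - z
  have hD : 𝓛 (CFC.sqrt V) D =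
      𝓛 (CFC.sqrt V - CFC.sqrt A) (𝓛 (CFC.sqrt A) h) - (s - 𝓛 A h) := by
    rw [map_sub, hz, toEuclideanCLM_sub_apply, toEuclideanCLM_sqrt_sqrt_apply hA]; abel
  have hD_le : √c * ‖D‖ ≤ (√(ε * C) + ε) * ‖h‖ :=
    calc √c * ‖D‖ ≤ ‖𝓛 (CFC.sqrt V) D‖ :=
          sqrt_mul_norm_le_norm_toEuclideanCLM_sqrt hV hc.le (hV_low D)
      _ ≤ √ε * (√C * ‖h‖) + ε * ‖h‖ := by
          refine hD ▸ (norm_sub_le _ _).trans (add_le_add ?_ hs)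
          refine (norm_toEuclideanCLM_apply_le _ _).trans ?_
          gcongr
          · exact Real.le_sqrt_of_sq_le ((norm_sqrt_sub_sqrt_sq_le hV hA).trans hVA)
          · exact (norm_toEuclideanCLM_sqrt_le hA h).trans (by gcongr)
      _ = (√(ε * C) + ε) * ‖h‖ := by rw [Real.sqrt_mul hε₀]; ring
  calc ‖D‖ = √c * ‖D‖ / √c := by field_simp
    _ ≤ (√(ε * C) + ε) * (2 / c * ‖s‖) / √c := by
        exact div_le_div_of_nonneg_right (hD_le.trans (by gcongr)) (Real.sqrt_nonneg c)
    _ = _ := by field_simp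

end Matrices

section MeasurableMatrices

variable {α ι : Type*} [MeasurableSpace α] {A : α → Matrix ι ι ℝ}

lemma measurable_comp_matrix_of_continuous [Finite ι] {E : Type*} [TopologicalSpace E]
    [MeasurableSpace E] [BorelSpace E] {g : Matrix ι ι ℝ → E} (hg : Continuous g)
    (hA : ∀ i j, Measurable fun ω => A ω i j) : Measurable fun ω => g (A ω) :=
  (show Continuous fun M : ι → ι → ℝ => g M from hg).measurable.comp
    (measurable_pi_lambda _ fun i => measurable_pi_lambda _ fun j => hA i j)

variable [Fintype ι] [DecidableEq ι]

lemma measurable_toEuclideanCLM_apply (hA : ∀ i j, Measurable fun ω => A ω i j)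
    {v : α → EuclideanSpace ℝ ι} (hv : Measurable v) : Measurable fun ω => 𝓛 (A ω) (v ω) := by
  have hmulVec : Measurable fun ω => A ω *ᵥ (v ω).ofLp := measurable_pi_lambda _ fun a => by
    simp only [mulVec, dotProduct]
    fun_prop
  exact (WithLp.measurable_toLp 2 _).comp hmulVec

lemma measurable_sqrt_apply (hA : ∀ i j, Measurable fun ω => A ω i j) (i j : ι) :
    Measurable fun ω => CFC.sqrt (A ω) i j := by
  classical
  let _ : MeasurableSpace (Matrix ι ι ℝ) := MeasurableSpace.pi
  have : BorelSpace (Matrix ι ι ℝ) := inferInstanceAs (BorelSpace (ι → ι → ℝ))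
  have hsqrt : (CFC.sqrt : Matrix ι ι ℝ → Matrix ι ι ℝ) =
      Set.piecewise {A | A.PosSemidef} CFC.sqrt 0 := by
    ext1 M
    by_cases hM : M.PosSemidef
    · simp [Set.piecewise, hM]
    · simp [Set.piecewise, hM, CFC.sqrt_of_not_nonneg fun h => hM h.posSemidef]
  have hmeas : Measurable (CFC.sqrt : Matrix ι ι ℝ → Matrix ι ι ℝ) := by
    rw [hsqrt]
    exact continuousOn_sqrt_posSemidef.measurable_piecewise continuousOn_const
      isClosed_posSemidef.measurableSet
  have hA' : Measurable A := measurable_comp_matrix_of_continuous continuous_id hA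
  exact (measurable_pi_apply j).comp ((measurable_pi_apply i).comp (hmeas.comp hA'))

end MeasurableMatrices

section CentralLimit

open Complex (I)

lemma norm_prod_sub_prod_le {κ : Type*} (s : Finset κ) {f g : κ → ℂ} (hf : ∀ i ∈ s, ‖f i‖ ≤ 1)
    (hg : ∀ i ∈ s, ‖g i‖ ≤ 1) : ‖∏ i ∈ s, f i - ∏ i ∈ s, g i‖ ≤ ∑ i ∈ s, ‖f i - g i‖ := by
  classical
  induction s using Finset.induction_on with
  | empty => simp
  | insert a s ha ih =>
    have hf' : ∀ i ∈ s, ‖f i‖ ≤ 1 := fun i hi => hf i (Finset.mem_insert_of_mem hi)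
    have hg' : ∀ i ∈ s, ‖g i‖ ≤ 1 := fun i hi => hg i (Finset.mem_insert_of_mem hi)
    rw [Finset.prod_insert ha, Finset.prod_insert ha, Finset.sum_insert ha]
    calc ‖f a * ∏ i ∈ s, f i - g a * ∏ i ∈ s, g i‖
        = ‖(f a - g a) * ∏ i ∈ s, f i + g a * (∏ i ∈ s, f i - ∏ i ∈ s, g i)‖ := by ring_nf
      _ ≤ ‖f a - g a‖ * ‖∏ i ∈ s, f i‖ + ‖g a‖ * ‖∏ i ∈ s, f i - ∏ i ∈ s, g i‖ :=
          (norm_add_le _ _).trans_eq (by rw [norm_mul, norm_mul])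
      _ ≤ ‖f a - g a‖ * 1 + 1 * ∑ i ∈ s, ‖f i - g i‖ := by
          gcongr
          · exact (norm_prod s f).trans_le (Finset.prod_le_one (fun _ _ => norm_nonneg _) hf')
          · exact hg a (Finset.mem_insert_self _ _)
          · exact ih hf' hg'
      _ = ‖f a - g a‖ + ∑ i ∈ s, ‖f i - g i‖ := by ring

lemma norm_exp_ofReal_mul_I_sub_taylor_le {x : ℝ} (hx : |x| ≤ 1) :
    ‖Complex.exp (x * I) - (1 + x * I - ((x ^ 2 : ℝ) : ℂ) / 2)‖ ≤ 3 * |x| ^ 3 := by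
  have hnorm : ‖(x * I : ℂ)‖ = |x| := by simp
  have htaylor : ∑ m ∈ Finset.range 3, (x * I : ℂ) ^ m / (m.factorial : ℂ) =
      1 + x * I - ((x ^ 2 : ℝ) : ℂ) / 2 := by
    simp only [Finset.sum_range_succ, Finset.sum_range_zero, mul_pow, Complex.I_sq,
      Nat.factorial]
    push_cast
    ring
  calc _ ≤ |x| ^ 3 * Real.exp |x| := by
        simpa only [htaylor, hnorm] using Complex.norm_exp_sub_sum_le_norm_mul_exp (x * I) 3
    _ ≤ |x| ^ 3 * 3 := by
        gcongr
        exact (Real.exp_le_exp.2 hx).trans Real.exp_one_lt_three.le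
    _ = 3 * |x| ^ 3 := mul_comm _ _

lemma norm_one_sub_half_sub_exp_le {v : ℝ} (hv : |v| ≤ 2) :
    ‖(1 - (v : ℂ) / 2) - Complex.exp (-(v : ℂ) / 2)‖ ≤ v ^ 2 / 4 := by
  have hreal : (1 - (v : ℂ) / 2) - Complex.exp (-(v : ℂ) / 2) =
      ((-(Real.exp (-v / 2) - 1 - -v / 2) : ℝ) : ℂ) := by
    push_cast; ring
  have hv2 : |-v / 2| ≤ 1 := by rw [abs_div, abs_neg, abs_two]; linarith
  rw [hreal, Complex.norm_real, norm_neg, Real.norm_eq_abs]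
  exact (Real.abs_exp_sub_one_sub_id_le hv2).trans_eq (by ring)

variable {Ω : Type*} [MeasurableSpace Ω] {P : Measure Ω}

variable {E : Type*} [NormedAddCommGroup E] [InnerProductSpace ℝ E] [FiniteDimensional ℝ E]
  [MeasurableSpace E] [BorelSpace E]

lemma charFun_map_clm_sum {ξ : ℕ → Ω → E} (hξ : ∀ i, Measurable (ξ i)) (hindep : iIndepFun ξ P)
    {L : E →L[ℝ] E} (hL : ∀ x y, ⟪L x, y⟫ = ⟪x, L y⟫) (n : ℕ) (t : E) :
    charFun (P.map fun ω => L (∑ i ∈ Finset.range n, ξ i ω)) t =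
      ∏ i ∈ Finset.range n, ∫ ω, Complex.exp ((⟪ξ i ω, L t⟫ : ℝ) * I) ∂P := by
  have hsymm : charFun (P.map fun ω => L (∑ i ∈ Finset.range n, ξ i ω)) t =
      charFun (P.map fun ω => ∑ i ∈ Finset.range n, ξ i ω) (L t) := by
    simp only [charFun_apply]
    rw [integral_map (by fun_prop) (by fun_prop), integral_map (by fun_prop) (by fun_prop)]
    simp only [hL]
  rw [hsymm, (hindep.restrict (Finset.range n)).charFun_map_fun_finsetSum_eq_prod
    (fun i _ => (hξ i).aemeasurable), Finset.prod_apply]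
  refine Finset.prod_congr rfl fun i _ => ?_
  rw [charFun_apply, integral_map (hξ i).aemeasurable (by fun_prop)]

variable [IsProbabilityMeasure P]

lemma norm_integral_exp_sub_one_sub_half_le {X : Ω → ℝ} (hX : Measurable X) {b : ℝ} (hb : b ≤ 1)
    (hXb : ∀ᵐ ω ∂P, |X ω| ≤ b) (hmean : ∫ ω, X ω ∂P = 0) :
    ‖∫ ω, Complex.exp (X ω * I) ∂P - (1 - ((∫ ω, X ω ^ 2 ∂P : ℝ) : ℂ) / 2)‖ ≤ 3 * b ^ 3 := by
  have hint : Integrable X P := .of_bound hX.aestronglyMeasurable b hXb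
  have hint_sq : Integrable (fun ω => X ω ^ 2) P :=
    (MemLp.of_bound (p := 2) hX.aestronglyMeasurable b hXb).integrable_sq
  have hint_exp : Integrable (fun ω => Complex.exp (X ω * I)) P :=
    .of_bound (by fun_prop) 1 (by simp [Complex.norm_exp_ofReal_mul_I])
  have hint_I : Integrable (fun ω => (X ω * I : ℂ)) P := hint.ofReal.mul_const I
  have hint_lin : Integrable (fun ω => (1 : ℂ) + X ω * I) P := (integrable_const _).add hint_I
  have hint_half : Integrable (fun ω => ((X ω ^ 2 : ℝ) : ℂ) / 2) P := hint_sq.ofReal.div_const 2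
  have htaylor : ∫ ω, ((1 : ℂ) + X ω * I - ((X ω ^ 2 : ℝ) : ℂ) / 2) ∂P =
      1 - ((∫ ω, X ω ^ 2 ∂P : ℝ) : ℂ) / 2 := by
    rw [integral_sub hint_lin hint_half, integral_add (integrable_const _) hint_I,
      integral_mul_const, integral_div, integral_complex_ofReal, integral_complex_ofReal, hmean]
    simp
  have hint_taylor : Integrable (fun ω => (1 : ℂ) + X ω * I - ((X ω ^ 2 : ℝ) : ℂ) / 2) P :=
    hint_lin.sub hint_half
  rw [← htaylor, ← integral_sub hint_exp hint_taylor]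
  refine (norm_integral_le_of_norm_le_const (C := 3 * b ^ 3) ?_).trans (by simp)
  filter_upwards [hXb] with ω hω
  exact (norm_exp_ofReal_mul_I_sub_taylor_le (hω.trans hb)).trans (by gcongr)

lemma norm_integral_exp_sub_exp_le {X : Ω → ℝ} (hX : Measurable X) {b : ℝ} (hb : b ≤ 1)
    (hXb : ∀ᵐ ω ∂P, |X ω| ≤ b) (hmean : ∫ ω, X ω ∂P = 0) :
    ‖∫ ω, Complex.exp (X ω * I) ∂P - Complex.exp (-((∫ ω, X ω ^ 2 ∂P : ℝ) : ℂ) / 2)‖ ≤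
      4 * b ^ 3 := by
  have hb₀ : 0 ≤ b := by
    obtain ⟨ω, hω⟩ := hXb.exists
    exact (abs_nonneg _).trans hω
  set v := ∫ ω, X ω ^ 2 ∂P
  have hv : |v| ≤ b ^ 2 := by
    have hsq : ∀ᵐ ω ∂P, ‖X ω ^ 2‖ ≤ b ^ 2 := by
      filter_upwards [hXb] with ω hω
      rw [norm_pow, Real.norm_eq_abs]
      gcongr
    simpa using norm_integral_le_of_norm_le_const hsq
  have hb_sq : b ^ 2 ≤ 1 := pow_le_one₀ hb₀ hb
  calc _ ≤ ‖∫ ω, Complex.exp (X ω * I) ∂P - (1 - (v : ℂ) / 2)‖ +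
        ‖(1 - (v : ℂ) / 2) - Complex.exp (-(v : ℂ) / 2)‖ := norm_sub_le_norm_sub_add_norm_sub _ _ _
    _ ≤ 3 * b ^ 3 + v ^ 2 / 4 := add_le_add (norm_integral_exp_sub_one_sub_half_le hX hb hXb hmean)
        (norm_one_sub_half_sub_exp_le (by linarith))
    _ ≤ 3 * b ^ 3 + b ^ 4 / 4 := by
        have : v ^ 2 ≤ (b ^ 2) ^ 2 := sq_le_sq.2 (hv.trans (le_abs_self _))
        linarith [pow_mul b 2 2]
    _ ≤ 4 * b ^ 3 := by
        have : b ^ 4 ≤ b ^ 3 := pow_le_pow_of_le_one hb₀ hb (by norm_num)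
        have : 0 ≤ b ^ 3 := by positivity
        linarith

lemma norm_charFun_map_clm_sum_sub_le {ξ : ℕ → Ω → E} (hξ : ∀ i, Measurable (ξ i))
    (hindep : iIndepFun ξ P) {K : ℝ} (hK : ∀ i, ∀ᵐ ω ∂P, ‖ξ i ω‖ ≤ K)
    (hmean : ∀ i u, ∫ ω, ⟪ξ i ω, u⟫ ∂P = 0) {L : E →L[ℝ] E} (hL : ∀ x y, ⟪L x, y⟫ = ⟪x, L y⟫)
    {n : ℕ} {t : E} (hvar : ∑ i ∈ Finset.range n, ∫ ω, ⟪ξ i ω, L t⟫ ^ 2 ∂P = ‖t‖ ^ 2)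
    {b : ℝ} (hb : b ≤ 1) (hKb : K * ‖L t‖ ≤ b) :
    ‖charFun (P.map fun ω => L (∑ i ∈ Finset.range n, ξ i ω)) t - charFun (stdGaussian E) t‖ ≤
      n * (4 * b ^ 3) := by
  have hgauss : charFun (stdGaussian E) t = ∏ i ∈ Finset.range n,
      Complex.exp (-((∫ ω, ⟪ξ i ω, L t⟫ ^ 2 ∂P : ℝ) : ℂ) / 2) := by
    rw [charFun_stdGaussian, ← Complex.exp_sum, ← Finset.sum_div, Finset.sum_neg_distrib,
      ← Complex.ofReal_sum, hvar]
    push_cast; rfl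
  rw [charFun_map_clm_sum hξ hindep hL, hgauss]
  refine (norm_prod_sub_prod_le _ (fun i _ => ?_) fun i _ => ?_).trans
    ((Finset.sum_le_card_nsmul _ _ (4 * b ^ 3) fun i _ => ?_).trans (by simp))
  · refine (norm_integral_le_of_norm_le_const (C := 1) ?_).trans (by simp)
    simp [Complex.norm_exp_ofReal_mul_I]
  · have : 0 ≤ ∫ ω, ⟪ξ i ω, L t⟫ ^ 2 ∂P := integral_nonneg fun _ => sq_nonneg _
    rw [← Complex.ofReal_neg, ← Complex.ofReal_ofNat, ← Complex.ofReal_div,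
      Complex.norm_exp_ofReal]
    exact Real.exp_le_one_iff.2 (by linarith)
  · refine norm_integral_exp_sub_exp_le (by fun_prop) hb ?_ (hmean i _)
    filter_upwards [hK i] with ω hω
    exact ((abs_real_inner_le_norm _ _).trans (by gcongr)).trans hKb

/-- Central limit theorem; `hsymm` and `hvar` say that `A n * Var (∑ ξ i) * A n = 1`. -/
theorem tendstoInDistribution_clm_sum {ξ : ℕ → Ω → E} (hξ : ∀ i, Measurable (ξ i))
    (hindep : iIndepFun ξ P) {K : ℝ} (hK : ∀ i, ∀ᵐ ω ∂P, ‖ξ i ω‖ ≤ K)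
    (hmean : ∀ i u, ∫ ω, ⟪ξ i ω, u⟫ ∂P = 0) {A : ℕ → E →L[ℝ] E}
    (hsymm : ∀ n x y, ⟪A n x, y⟫ = ⟪x, A n y⟫) {c : ℝ} (hc : 0 < c)
    (hA : ∀ᶠ n : ℕ in atTop, ∀ u, c * n * ‖A n u‖ ^ 2 ≤ ‖u‖ ^ 2)
    (hvar : ∀ᶠ n in atTop, ∀ u, ∑ i ∈ Finset.range n, ∫ ω, ⟪ξ i ω, A n u⟫ ^ 2 ∂P = ‖u‖ ^ 2) :
    TendstoInDistribution (fun n ω => A n (∑ i ∈ Finset.range n, ξ i ω)) atTop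
      (fun z : E => z) (fun _ => P) (stdGaussian E) where
  forall_aemeasurable n := by fun_prop
  aemeasurable_limit := by fun_prop
  tendsto := by
    have hK₀ : 0 ≤ K := by
      obtain ⟨ω, hω⟩ := (hK 0).exists
      exact (norm_nonneg _).trans hω
    refine ProbabilityMeasure.tendsto_iff_tendsto_charFun.2 fun t => ?_
    simp only [ProbabilityMeasure.coe_mk, Measure.map_id']
    rw [tendsto_iff_norm_sub_tendsto_zero]
    set b : ℕ → ℝ := fun n => K * ‖t‖ / √(c * n) with hb_def
    have hsqrt : Tendsto (fun n : ℕ => √(c * n)) atTop atTop :=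
      Real.tendsto_sqrt_atTop.comp (tendsto_natCast_atTop_atTop.const_mul_atTop hc)
    have hb : Tendsto b atTop (𝓝 0) := hsqrt.const_div_atTop _
    have hlim : Tendsto (fun n : ℕ => n * (4 * b n ^ 3)) atTop (𝓝 0) := by
      refine (hsqrt.const_div_atTop (4 * (K * ‖t‖) ^ 3 / c)).congr' ?_
      filter_upwards [eventually_gt_atTop 0] with n hn
      have hcube : √(c * n) ^ 3 = c * n * √(c * n) := by
        rw [pow_succ, Real.sq_sqrt (by positivity)]
      rw [hb_def, div_pow, hcube]
      field_simp
    refine squeeze_zero' (Eventually.of_forall fun _ => norm_nonneg _) ?_ hlim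
    filter_upwards [hA, hvar, hb.eventually_le_const one_pos, eventually_gt_atTop 0]
      with n hAn hvar_n hbn hn
    refine norm_charFun_map_clm_sum_sub_le hξ hindep hK hmean (hsymm n) (hvar_n t) hbn ?_
    simp only [hb_def, mul_div_assoc]
    gcongr
    rw [le_div_iff₀ (by positivity), ← sq_le_sq₀ (by positivity) (by positivity), mul_pow,
      Real.sq_sqrt (by positivity)]
    linarith [hAn t]

end CentralLimit

section LargeNumbers

variable {Ω : Type*} [MeasurableSpace Ω] {P : Measure Ω}

lemma tendstoInMeasure_of_le_sum {κ : Type*} (s : Finset κ) {f : ℕ → Ω → ℝ}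
    {g : κ → ℕ → Ω → ℝ} (hg : ∀ j ∈ s, TendstoInMeasure P (g j) atTop 0)
    (hfg : ∀ n ω, |f n ω| ≤ ∑ j ∈ s, |g j n ω|) : TendstoInMeasure P f atTop 0 := by
  rw [tendstoInMeasure_iff_norm]
  intro ε hε
  set N : ℝ := s.card + 1
  have hN : 0 < N := by positivity
  have hlim : Tendsto (fun n => ∑ j ∈ s, P {ω | ε / N ≤ ‖g j n ω - (0 : Ω → ℝ) ω‖})
      atTop (𝓝 0) := by
    simpa using tendsto_finsetSum s fun j hj =>
      tendstoInMeasure_iff_norm.1 (hg j hj) (ε / N) (by positivity)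
  refine tendsto_of_tendsto_of_tendsto_of_le_of_le tendsto_const_nhds hlim (fun _ => zero_le)
    fun n => (measure_mono fun ω hω => ?_).trans (measure_biUnion_finset_le s _)
  simp only [Set.mem_ofPred_eq, Pi.zero_apply, sub_zero, Set.mem_iUnion, Real.norm_eq_abs] at hω ⊢
  by_contra! hsmall
  have hsum : ∑ j ∈ s, |g j n ω| ≤ s.card • (ε / N) :=
    Finset.sum_le_card_nsmul _ _ _ fun j hj => (hsmall j hj).le
  have hcard : s.card • (ε / N) < ε := by
    rw [nsmul_eq_mul, mul_div_assoc', div_lt_iff₀ hN, mul_comm]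
    gcongr
    exact lt_add_one _
  linarith [hfg n ω]

variable [IsProbabilityMeasure P]

lemma variance_sum_le {Z : ℕ → Ω → ℝ} (hZ : ∀ i, Measurable (Z i)) (hindep : iIndepFun Z P)
    {K : ℝ} (hK : ∀ i, ∀ᵐ ω ∂P, |Z i ω| ≤ K) (n : ℕ) :
    Var[∑ i ∈ Finset.range n, Z i; P] ≤ n * K ^ 2 := by
  have hL2 : ∀ i, MemLp (Z i) 2 P := fun i => .of_bound (hZ i).aestronglyMeasurable K (hK i)
  rw [IndepFun.variance_sum (fun i _ => hL2 i) fun i _ j _ hij => hindep.indepFun hij]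
  refine (Finset.sum_le_card_nsmul _ _ (K ^ 2) fun i _ => ?_).trans (by simp)
  refine (variance_le_expectation_sq (hZ i).aestronglyMeasurable).trans ?_
  have hsq : ∀ᵐ ω ∂P, ‖(Z i ^ 2) ω‖ ≤ K ^ 2 := by
    filter_upwards [hK i] with ω hω
    rw [Pi.pow_apply, norm_pow, Real.norm_eq_abs]
    gcongr
  simpa using (le_abs_self _).trans (norm_integral_le_of_norm_le_const hsq)

theorem tendstoInMeasure_sum_sub_integral_div {Z : ℕ → Ω → ℝ} (hZ : ∀ i, Measurable (Z i))
    (hindep : iIndepFun Z P) {K : ℝ} (hK : ∀ i, ∀ᵐ ω ∂P, |Z i ω| ≤ K) :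
    TendstoInMeasure P (fun (n : ℕ) ω =>
      (∑ i ∈ Finset.range n, Z i ω - ∑ i ∈ Finset.range n, ∫ ω, Z i ω ∂P) / n) atTop 0 := by
  have hL2 : ∀ i, MemLp (Z i) 2 P := fun i => .of_bound (hZ i).aestronglyMeasurable K (hK i)
  rw [tendstoInMeasure_iff_norm]
  intro ε hε
  have hlim : Tendsto (fun n : ℕ => ENNReal.ofReal (K ^ 2 / ε ^ 2 / n)) atTop (𝓝 0) := by
    simpa using ENNReal.tendsto_ofReal (tendsto_const_div_atTop_nhds_zero_nat (K ^ 2 / ε ^ 2))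
  refine tendsto_of_tendsto_of_tendsto_of_le_of_le' tendsto_const_nhds hlim
    (Eventually.of_forall fun _ => zero_le) ?_
  filter_upwards [eventually_gt_atTop 0] with n hn
  have hn₀ : (0 : ℝ) < n := by exact_mod_cast hn
  have hmean : ∫ ω, (∑ i ∈ Finset.range n, Z i) ω ∂P = ∑ i ∈ Finset.range n, ∫ ω, Z i ω ∂P := by
    simp only [Finset.sum_apply]
    exact integral_finsetSum _ fun i _ => (hL2 i).integrable (by norm_num)
  have hchebyshev := meas_ge_le_variance_div_sq (memLp_finsetSum' (Finset.range n) fun i _ => hL2 i)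
    (c := ε * n) (by positivity)
  refine (measure_mono fun ω hω => ?_).trans (hchebyshev.trans (ENNReal.ofReal_le_ofReal ?_))
  · simp only [Set.mem_ofPred_eq, Pi.zero_apply, sub_zero, norm_div, Real.norm_eq_abs,
      Nat.abs_cast] at hω ⊢
    rw [le_div_iff₀ hn₀] at hω
    rw [hmean]
    simpa using hω
  · rw [div_le_iff₀ (by positivity)]
    exact (variance_sum_le hZ hindep hK n).trans_eq (by field_simp)

variable {ι : Type*} [Fintype ι] {ξ : ℕ → Ω → EuclideanSpace ℝ ι} {K : ℝ}

lemma integral_norm_sum_sq_le (hξ : ∀ i, Measurable (ξ i)) (hindep : iIndepFun ξ P)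
    (hK : ∀ i, ∀ᵐ ω ∂P, ‖ξ i ω‖ ≤ K) (hmean : ∀ i u, ∫ ω, ⟪ξ i ω, u⟫ ∂P = 0) (n : ℕ) :
    ∫ ω, ‖∑ i ∈ Finset.range n, ξ i ω‖ ^ 2 ∂P ≤ Fintype.card ι * (n * K ^ 2) := by
  have hcoord : ∀ a i, Measurable fun ω => ξ i ω a := fun a i => by fun_prop
  have hbound : ∀ a i, ∀ᵐ ω ∂P, |ξ i ω a| ≤ K := fun a i => by
    filter_upwards [hK i] with ω hω
    exact (PiLp.norm_apply_le _ _).trans hω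
  have hL2 : ∀ a i, MemLp (fun ω => ξ i ω a) 2 P := fun a i =>
    .of_bound (hcoord a i).aestronglyMeasurable K (hbound a i)
  have hsum : ∀ a, MemLp (∑ i ∈ Finset.range n, fun ω => ξ i ω a) 2 P := fun a =>
    memLp_finsetSum' _ fun i _ => hL2 a i
  have hcentered : ∀ a, ∫ ω, (∑ i ∈ Finset.range n, fun ω => ξ i ω a) ω ∂P = 0 := fun a => by
    classical
    simp only [Finset.sum_apply]
    rw [integral_finsetSum _ fun i _ => (hL2 a i).integrable (by norm_num)]
    refine Finset.sum_eq_zero fun i _ => ?_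
    simpa [EuclideanSpace.inner_single_right] using hmean i (EuclideanSpace.single a 1)
  have hsq : ∀ a, ∫ ω, (∑ i ∈ Finset.range n, fun ω => ξ i ω a) ω ^ 2 ∂P ≤ n * K ^ 2 := fun a => by
    have hindep_coord : iIndepFun (fun i ω => ξ i ω a) P :=
      hindep.comp (fun _ x => x a) fun _ => by fun_prop
    refine le_of_eq_of_le ?_ (variance_sum_le (hcoord a) hindep_coord (hbound a) n)
    rw [variance_of_integral_eq_zero (hsum a).aestronglyMeasurable.aemeasurable (hcentered a)]
  have hnorm : ∀ ω, ‖∑ i ∈ Finset.range n, ξ i ω‖ ^ 2 =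
      ∑ a, (∑ i ∈ Finset.range n, fun ω => ξ i ω a) ω ^ 2 := fun ω => by
    simp [EuclideanSpace.real_norm_sq_eq]
  simp only [hnorm]
  rw [integral_finsetSum _ fun a _ => (hsum a).integrable_sq]
  exact (Finset.sum_le_card_nsmul _ _ _ fun a _ => hsq a).trans (by simp)

lemma measure_norm_sum_div_sqrt_ge_le (hξ : ∀ i, Measurable (ξ i)) (hindep : iIndepFun ξ P)
    (hK : ∀ i, ∀ᵐ ω ∂P, ‖ξ i ω‖ ≤ K) (hmean : ∀ i u, ∫ ω, ⟪ξ i ω, u⟫ ∂P = 0)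
    {n : ℕ} (hn : 0 < n) {M : ℝ} (hM : 0 < M) :
    P {ω | M ≤ ‖∑ i ∈ Finset.range n, ξ i ω‖ / √n} ≤
      ENNReal.ofReal (Fintype.card ι * K ^ 2 / M ^ 2) := by
  have hn₀ : (0 : ℝ) < n := by exact_mod_cast hn
  have hset : {ω | M ≤ ‖∑ i ∈ Finset.range n, ξ i ω‖ / √n} =
      {ω | M ^ 2 * n ≤ ‖∑ i ∈ Finset.range n, ξ i ω‖ ^ 2} := by
    ext ω
    rw [Set.mem_ofPred_eq, Set.mem_ofPred_eq, le_div_iff₀ (Real.sqrt_pos.2 hn₀),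
      ← sq_le_sq₀ (by positivity) (norm_nonneg _), mul_pow, Real.sq_sqrt hn₀.le]
  have hL2 : MemLp (fun ω => ∑ i ∈ Finset.range n, ξ i ω) 2 P :=
    memLp_finsetSum _ fun i _ => .of_bound (hξ i).aestronglyMeasurable K (hK i)
  have hmarkov := (mul_meas_ge_le_integral_of_nonneg (μ := P)
    (Eventually.of_forall fun _ => sq_nonneg _) (hL2.integrable_norm_pow two_ne_zero)
    (M ^ 2 * n)).trans (integral_norm_sum_sq_le hξ hindep hK hmean n)
  rw [hset, ← ofReal_measureReal]
  refine ENNReal.ofReal_le_ofReal ?_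
  rw [le_div_iff₀ (by positivity)]
  refine le_of_mul_le_mul_left ?_ hn₀
  linarith

end LargeNumbers

/-- The density of the standard normal distribution, that is, the derivative of `stdNormalCDF`. -/
def stdNormalPDF (t : ℝ) : ℝ := gaussianPDFReal 0 1 t

lemma stdNormalPDF_eq : stdNormalPDF = fun t => (√(2 * Real.pi))⁻¹ * Real.exp (-t ^ 2 / 2) := by
  ext t
  simp [stdNormalPDF, gaussianPDFReal]

lemma stdNormalPDF_pos (t : ℝ) : 0 < stdNormalPDF t := gaussianPDFReal_pos _ _ _ one_ne_zero

lemma contDiff_stdNormalPDF : ContDiff ℝ (⊤ : ℕ∞) stdNormalPDF := by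
  rw [stdNormalPDF_eq]
  fun_prop

lemma stdNormalCDF_eq_integral (t : ℝ) : stdNormalCDF t = ∫ x in Set.Iic t, stdNormalPDF x := by
  rw [stdNormalCDF, cdf_eq_real, measureReal_def, gaussianReal_apply_eq_integral 0 one_ne_zero]
  exact ENNReal.toReal_ofReal (integral_nonneg fun x => (stdNormalPDF_pos x).le)

lemma hasDerivAt_stdNormalCDF (t : ℝ) : HasDerivAt stdNormalCDF (stdNormalPDF t) t := by
  have hint : Integrable stdNormalPDF := integrable_gaussianPDFReal 0 1
  have hcont : Continuous stdNormalPDF := contDiff_stdNormalPDF.continuous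
  have heq : stdNormalCDF = fun t => (∫ x in (0 : ℝ)..t, stdNormalPDF x) + stdNormalCDF 0 := by
    ext t
    rw [stdNormalCDF_eq_integral t, stdNormalCDF_eq_integral 0,
      ← intervalIntegral.integral_Iic_sub_Iic hint.integrableOn hint.integrableOn,
      sub_add_cancel]
  rw [heq]
  exact (intervalIntegral.integral_hasDerivAt_right hint.intervalIntegrable
    (hcont.stronglyMeasurableAtFilter _ _) hcont.continuousAt).add_const _

lemma deriv_stdNormalCDF : deriv stdNormalCDF = stdNormalPDF :=
  funext fun t => (hasDerivAt_stdNormalCDF t).deriv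

lemma contDiff_stdNormalCDF : ContDiff ℝ (⊤ : ℕ∞) stdNormalCDF :=
  contDiff_infty_iff_deriv.2
    ⟨fun t => (hasDerivAt_stdNormalCDF t).differentiableAt,
      deriv_stdNormalCDF ▸ contDiff_stdNormalPDF⟩

lemma strictMono_stdNormalCDF : StrictMono stdNormalCDF :=
  strictMono_of_deriv_pos fun t => deriv_stdNormalCDF ▸ stdNormalPDF_pos t

lemma stdNormalCDF_pos (t : ℝ) : 0 < stdNormalCDF t :=
  (cdf_nonneg _ (t - 1)).trans_lt (strictMono_stdNormalCDF (sub_one_lt t))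

lemma stdNormalCDF_lt_one (t : ℝ) : stdNormalCDF t < 1 :=
  (strictMono_stdNormalCDF (lt_add_one t)).trans_le (cdf_le_one _ _)

/-- The probability `1 - F a` that an observation with zero-inflation predictor `a` is not a
structural zero. -/
def binomWeight (a : ℝ) : ℝ := 1 - stdNormalCDF a

/-- The binomial probability of the value `y` out of `m` trials, with success probability `F b`,
minus the probability of `y` under a structural zero. -/
def binomShift (m y : ℕ) (b : ℝ) : ℝ :=
  (bernsteinPolynomial ℝ m y).eval (stdNormalCDF b) - if y = 0 then 1 else 0

/-- The probability of the observation `y` out of `m` trials as a function of the values `a`, `b`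
of the two linear predictors. -/
def obsProb (m y : ℕ) (a b : ℝ) : ℝ := zibProb m (stdNormalCDF a) (stdNormalCDF b) y

/-- The partial derivative of order `(k, l)` of the probability of `y`, divided by that
probability; for `k + l ≥ 1` the numerator is a product by `obsProb_eq`. -/
def relDeriv (m y k l : ℕ) (a b : ℝ) : ℝ :=
  iteratedDeriv k binomWeight a * iteratedDeriv l (binomShift m y) b / obsProb m y a b

/-- The second derivative `∂²/∂a²` of the log-likelihood of an observation. -/
def obsDerivAA (m y : ℕ) (a b : ℝ) : ℝ := relDeriv m y 2 0 a b - relDeriv m y 1 0 a b ^ 2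

/-- The second derivative `∂²/∂a∂b` of the log-likelihood of an observation. -/
def obsDerivAB (m y : ℕ) (a b : ℝ) : ℝ :=
  relDeriv m y 1 1 a b - relDeriv m y 1 0 a b * relDeriv m y 0 1 a b

/-- The second derivative `∂²/∂b²` of the log-likelihood of an observation. -/
def obsDerivBB (m y : ℕ) (a b : ℝ) : ℝ := relDeriv m y 0 2 a b - relDeriv m y 0 1 a b ^ 2

section Observation

variable {m y : ℕ}

lemma contDiff_binomWeight : ContDiff ℝ (⊤ : ℕ∞) binomWeight :=
  contDiff_const.sub contDiff_stdNormalCDF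

lemma contDiff_binomShift (m y : ℕ) : ContDiff ℝ (⊤ : ℕ∞) (binomShift m y) :=
  (((bernsteinPolynomial ℝ m y).contDiff_aeval _).comp contDiff_stdNormalCDF).sub contDiff_const

lemma iteratedDeriv_one_binomWeight_neg (a : ℝ) : iteratedDeriv 1 binomWeight a < 0 := by
  have hderiv : HasDerivAt binomWeight (-stdNormalPDF a) a :=
    (hasDerivAt_stdNormalCDF a).const_sub 1
  rw [iteratedDeriv_one, hderiv.deriv]
  exact neg_neg_of_pos (stdNormalPDF_pos a)

lemma binomShift_zero_neg (hm : m ≠ 0) (b : ℝ) : binomShift m 0 b < 0 := by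
  have : (1 - stdNormalCDF b) ^ m < 1 :=
    pow_lt_one₀ (sub_nonneg.2 (stdNormalCDF_lt_one b).le)
      (sub_lt_self _ (stdNormalCDF_pos b)) hm
  simpa [binomShift, bernsteinPolynomial] using this

lemma sum_binomShift (m : ℕ) (b : ℝ) : ∑ y ∈ Finset.range (m + 1), binomShift m y b = 0 := by
  simp [binomShift, Finset.sum_sub_distrib, ← Polynomial.eval_finsetSum,
    bernsteinPolynomial.sum ℝ m]

lemma sum_iteratedDeriv_binomShift (m l : ℕ) (b : ℝ) :
    ∑ y ∈ Finset.range (m + 1), iteratedDeriv l (binomShift m y) b = 0 := by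
  rw [← iteratedDeriv_fun_sum fun y _ =>
    ((contDiff_binomShift m y).of_le (mod_cast le_top)).contDiffAt]
  simp [sum_binomShift]

lemma obsProb_eq (m y : ℕ) (a b : ℝ) :
    obsProb m y a b = (if y = 0 then 1 else 0) + binomWeight a * binomShift m y b := by
  simp only [obsProb, zibProb, binomWeight, binomShift, bernsteinPolynomial, Polynomial.eval_mul,
    Polynomial.eval_pow, Polynomial.eval_natCast, Polynomial.eval_X, Polynomial.eval_sub,
    Polynomial.eval_one]
  split_ifs <;> ring

lemma obsProb_eq_zero (h : m < y) (a b : ℝ) : obsProb m y a b = 0 := by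
  simp [obsProb, zibProb, Nat.choose_eq_zero_of_lt h, (Nat.zero_le m).trans_lt h |>.ne']

lemma obsProb_pos (h : y ≤ m) (a b : ℝ) : 0 < obsProb m y a b := by
  have hchoose : (0 : ℝ) < m.choose y := mod_cast Nat.choose_pos h
  have ha := stdNormalCDF_pos a
  have ha' := sub_pos.2 (stdNormalCDF_lt_one a)
  have hb := stdNormalCDF_pos b
  have hb' := sub_pos.2 (stdNormalCDF_lt_one b)
  unfold obsProb zibProb
  split_ifs <;> positivity

lemma continuous_obsProb (m y : ℕ) : Continuous fun z : ℝ × ℝ => obsProb m y z.1 z.2 := by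
  have hweight := contDiff_binomWeight.continuous
  have hshift := (contDiff_binomShift m y).continuous
  simp only [obsProb_eq]
  fun_prop

lemma relDeriv_eq_zero (h : m < y) (k l : ℕ) (a b : ℝ) : relDeriv m y k l a b = 0 := by
  simp [relDeriv, obsProb_eq_zero h]

lemma continuous_relDeriv (m y k l : ℕ) :
    Continuous fun z : ℝ × ℝ => relDeriv m y k l z.1 z.2 := by
  rcases lt_or_ge m y with h | h
  · simpa only [relDeriv_eq_zero h] using continuous_const
  · have hweight := contDiff_binomWeight.continuous_iteratedDeriv k (mod_cast le_top)
    have hshift := (contDiff_binomShift m y).continuous_iteratedDeriv l (mod_cast le_top)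
    exact Continuous.div (by fun_prop) (continuous_obsProb m y) fun z => (obsProb_pos h _ _).ne'

lemma sum_obsProb_mul_relDeriv (m k l : ℕ) (a b : ℝ) :
    ∑ y ∈ Finset.range (m + 1), obsProb m y a b * relDeriv m y k l a b = 0 := by
  have hcancel : ∀ y ∈ Finset.range (m + 1), obsProb m y a b * relDeriv m y k l a b =
      iteratedDeriv k binomWeight a * iteratedDeriv l (binomShift m y) b := fun y hy =>
    mul_div_cancel₀ _ (obsProb_pos (Finset.mem_range_succ_iff.1 hy) a b).ne'
  rw [Finset.sum_congr rfl hcancel, ← Finset.mul_sum, sum_iteratedDeriv_binomShift, mul_zero]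

lemma continuous_obsDerivAA (m y : ℕ) : Continuous fun z : ℝ × ℝ => obsDerivAA m y z.1 z.2 :=
  (continuous_relDeriv m y 2 0).sub ((continuous_relDeriv m y 1 0).pow 2)

lemma continuous_obsDerivAB (m y : ℕ) : Continuous fun z : ℝ × ℝ => obsDerivAB m y z.1 z.2 :=
  (continuous_relDeriv m y 1 1).sub
    ((continuous_relDeriv m y 1 0).mul (continuous_relDeriv m y 0 1))

lemma continuous_obsDerivBB (m y : ℕ) : Continuous fun z : ℝ × ℝ => obsDerivBB m y z.1 z.2 :=
  (continuous_relDeriv m y 0 2).sub ((continuous_relDeriv m y 0 1).pow 2)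

end Observation

/-- `ga` and `gb` are the partial derivatives of the differentiable function `g` of two real
variables. -/
def HasGrad (g ga gb : ℝ → ℝ → ℝ) : Prop :=
  ∀ a b, HasFDerivAt (fun z : ℝ × ℝ => g z.1 z.2)
    (ga a b • ContinuousLinearMap.fst ℝ ℝ ℝ + gb a b • ContinuousLinearMap.snd ℝ ℝ ℝ) (a, b)

namespace HasGrad

variable {f fa fb g ga gb : ℝ → ℝ → ℝ}

lemma hasDerivAt_left (h : HasGrad g ga gb) (a b : ℝ) :
    HasDerivAt (fun t => g t b) (ga a b) a := by
  have := (h a b).comp_hasDerivAt a ((hasDerivAt_id a).prodMk (hasDerivAt_const a b))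
  simpa [Function.comp_def] using this

lemma hasDerivAt_right (h : HasGrad g ga gb) (a b : ℝ) :
    HasDerivAt (fun t => g a t) (gb a b) b := by
  have := (h a b).comp_hasDerivAt b ((hasDerivAt_const b a).prodMk (hasDerivAt_id b))
  simpa [Function.comp_def] using this

lemma comp {E : Type*} [NormedAddCommGroup E] [NormedSpace ℝ E] (h : HasGrad g ga gb)
    (α β : E →L[ℝ] ℝ) (x : E) :
    HasFDerivAt (fun x => g (α x) (β x)) (ga (α x) (β x) • α + gb (α x) (β x) • β) x := by
  refine ((h (α x) (β x)).comp x (α.hasFDerivAt.prodMk β.hasFDerivAt)).congr_fderiv ?_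
  ext v
  simp

lemma of_hasDerivAt_mul {u u' v v' : ℝ → ℝ} (hu : ∀ a, HasDerivAt u (u' a) a)
    (hv : ∀ b, HasDerivAt v (v' b) b) :
    HasGrad (fun a b => u a * v b) (fun a b => u' a * v b) (fun a b => u a * v' b) := by
  intro a b
  have hu' : HasFDerivAt (fun z : ℝ × ℝ => u z.1) (u' a • ContinuousLinearMap.fst ℝ ℝ ℝ) (a, b) :=
    (hu a).comp_hasFDerivAt (a, b) hasFDerivAt_fst
  have hv' : HasFDerivAt (fun z : ℝ × ℝ => v z.2) (v' b • ContinuousLinearMap.snd ℝ ℝ ℝ) (a, b) :=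
    (hv b).comp_hasFDerivAt (a, b) hasFDerivAt_snd
  refine (hu'.mul hv').congr_fderiv ?_
  ext <;> simp [mul_comm]

lemma div (hf : HasGrad f fa fb) (hg : HasGrad g ga gb) (hne : ∀ a b, g a b ≠ 0) :
    HasGrad (fun a b => f a b / g a b)
      (fun a b => fa a b / g a b - f a b / g a b * (ga a b / g a b))
      (fun a b => fb a b / g a b - f a b / g a b * (gb a b / g a b)) := by
  intro a b
  have hinv : HasFDerivAt (fun z : ℝ × ℝ => (g z.1 z.2)⁻¹)
      (-(g a b ^ 2)⁻¹ • (ga a b • ContinuousLinearMap.fst ℝ ℝ ℝ +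
        gb a b • ContinuousLinearMap.snd ℝ ℝ ℝ)) (a, b) :=
    (hasDerivAt_inv (hne a b)).comp_hasFDerivAt (a, b) (hg a b)
  simp only [div_eq_mul_inv]
  refine ((hf a b).mul hinv).congr_fderiv ?_
  ext <;> simp <;> ring

end HasGrad

section ObservationDerivatives

variable (m y : ℕ)

lemma hasGrad_iteratedDeriv_mul (k l : ℕ) :
    HasGrad (fun a b => iteratedDeriv k binomWeight a * iteratedDeriv l (binomShift m y) b)
      (fun a b => iteratedDeriv (k + 1) binomWeight a * iteratedDeriv l (binomShift m y) b)
      (fun a b => iteratedDeriv k binomWeight a * iteratedDeriv (l + 1) (binomShift m y) b) := by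
  refine .of_hasDerivAt_mul (fun a => ?_) (fun b => ?_)
  · rw [iteratedDeriv_succ]
    exact (contDiff_binomWeight.differentiable_iteratedDeriv k
      (mod_cast ENat.natCast_lt_top k) a).hasDerivAt
  · rw [iteratedDeriv_succ]
    exact ((contDiff_binomShift m y).differentiable_iteratedDeriv l
      (mod_cast ENat.natCast_lt_top l) b).hasDerivAt

lemma hasGrad_obsProb : HasGrad (obsProb m y)
    (fun a b => iteratedDeriv 1 binomWeight a * iteratedDeriv 0 (binomShift m y) b)
    (fun a b => iteratedDeriv 0 binomWeight a * iteratedDeriv 1 (binomShift m y) b) := by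
  intro a b
  simp only [obsProb_eq]
  exact (hasGrad_iteratedDeriv_mul m y 0 0 a b).const_add _

lemma hasGrad_obsLogLik : HasGrad (obsLogLik m y) (relDeriv m y 1 0) (relDeriv m y 0 1) := by
  intro a b
  change HasFDerivAt (fun z : ℝ × ℝ => Real.log (obsProb m y z.1 z.2)) _ _
  rcases lt_or_ge m y with h | h
  · simpa only [relDeriv_eq_zero h, obsProb_eq_zero h, Real.log_zero, zero_smul, add_zero] using
      hasFDerivAt_const (0 : ℝ) (a, b)
  · refine ((Real.hasDerivAt_log (obsProb_pos h a b).ne').comp_hasFDerivAt (a, b)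
      (hasGrad_obsProb m y a b)).congr_fderiv ?_
    simp only [relDeriv, smul_add, smul_smul, div_eq_inv_mul]

lemma hasGrad_relDeriv (k l : ℕ) : HasGrad (relDeriv m y k l)
    (fun a b => relDeriv m y (k + 1) l a b - relDeriv m y k l a b * relDeriv m y 1 0 a b)
    (fun a b => relDeriv m y k (l + 1) a b - relDeriv m y k l a b * relDeriv m y 0 1 a b) := by
  rcases lt_or_ge m y with h | h
  · intro a b
    simpa [relDeriv_eq_zero h] using hasFDerivAt_const (0 : ℝ) (a, b)
  · exact (hasGrad_iteratedDeriv_mul m y k l).div (hasGrad_obsProb m y)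
      fun a b => (obsProb_pos h a b).ne'

lemma hasGrad_relDeriv_one_zero :
    HasGrad (relDeriv m y 1 0) (obsDerivAA m y) (obsDerivAB m y) := by
  simpa only [← sq] using! hasGrad_relDeriv m y 1 0

lemma hasGrad_relDeriv_zero_one :
    HasGrad (relDeriv m y 0 1) (obsDerivAB m y) (obsDerivBB m y) := by
  simpa only [← sq, mul_comm (relDeriv m y 0 1 _ _)] using! hasGrad_relDeriv m y 0 1

lemma sum_obsProb_mul_score (a b α β : ℝ) :
    ∑ y ∈ Finset.range (m + 1),
      obsProb m y a b * (relDeriv m y 1 0 a b * α + relDeriv m y 0 1 a b * β) = 0 := by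
  simp only [mul_add, ← mul_assoc, Finset.sum_add_distrib, ← Finset.sum_mul,
    sum_obsProb_mul_relDeriv, zero_mul, add_zero]

/-- The information equality for one observation: the squares of the first derivatives cancel,
and the relative derivatives of order two have mean zero. -/
lemma sum_obsProb_mul_score_sq_add (a b α β : ℝ) :
    ∑ y ∈ Finset.range (m + 1), obsProb m y a b *
      ((relDeriv m y 1 0 a b * α + relDeriv m y 0 1 a b * β) ^ 2 +
        (obsDerivAA m y a b * α ^ 2 + 2 * obsDerivAB m y a b * α * β + obsDerivBB m y a b * β ^ 2))
      = 0 := by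
  have hcancel : ∀ y, obsProb m y a b *
      ((relDeriv m y 1 0 a b * α + relDeriv m y 0 1 a b * β) ^ 2 +
        (obsDerivAA m y a b * α ^ 2 + 2 * obsDerivAB m y a b * α * β +
          obsDerivBB m y a b * β ^ 2)) =
      obsProb m y a b * relDeriv m y 2 0 a b * α ^ 2 +
      obsProb m y a b * relDeriv m y 1 1 a b * (2 * α * β) +
      obsProb m y a b * relDeriv m y 0 2 a b * β ^ 2 :=
    fun y => by simp only [obsDerivAA, obsDerivAB, obsDerivBB]; ring
  simp only [hcancel, Finset.sum_add_distrib, ← Finset.sum_mul, sum_obsProb_mul_relDeriv, zero_mul,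
    add_zero]

end ObservationDerivatives

/-- The covariates `x` of the zero-inflation component as a vector of the parameter space, so that
`zeroPredictor θ x` is an inner product. -/
def embZero (x : EuclideanSpace ℝ (Fin p)) : Param p q :=
  WithLp.toLp 2 (Sum.elim (fun j => x j) fun _ => 0)

/-- The covariates `w` of the binomial component as a vector of the parameter space, so that
`binomPredictor θ w` is an inner product. -/
def embBinom (w : EuclideanSpace ℝ (Fin q)) : Param p q :=
  WithLp.toLp 2 (Sum.elim (fun _ => 0) fun j => w j)

/-- The contribution of one observation to the score. -/
def obsScore (m y : ℕ) (x : EuclideanSpace ℝ (Fin p)) (w : EuclideanSpace ℝ (Fin q))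
    (θ : Param p q) : Param p q :=
  relDeriv m y 1 0 (zeroPredictor θ x) (binomPredictor θ w) • embZero x +
    relDeriv m y 0 1 (zeroPredictor θ x) (binomPredictor θ w) • embBinom w

/-- The contribution of one observation to the Hessian matrix. -/
def obsHess (m y : ℕ) (x : EuclideanSpace ℝ (Fin p)) (w : EuclideanSpace ℝ (Fin q))
    (θ : Param p q) : Matrix (Fin p ⊕ Fin q) (Fin p ⊕ Fin q) ℝ :=
  let u : Param p q := embZero x
  let v : Param p q := embBinom w
  obsDerivAA m y (zeroPredictor θ x) (binomPredictor θ w) • vecMulVec u u +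
    obsDerivAB m y (zeroPredictor θ x) (binomPredictor θ w) • (vecMulVec u v + vecMulVec v u) +
    obsDerivBB m y (zeroPredictor θ x) (binomPredictor θ w) • vecMulVec v v

section Observation

variable {m y : ℕ} {x : EuclideanSpace ℝ (Fin p)} {w : EuclideanSpace ℝ (Fin q)} {θ : Param p q}

lemma zeroPredictor_eq_inner (θ : Param p q) (x : EuclideanSpace ℝ (Fin p)) :
    zeroPredictor θ x = ⟪embZero x, θ⟫ := by
  simp [zeroPredictor, betaPart, embZero, PiLp.inner_apply]

lemma binomPredictor_eq_inner (θ : Param p q) (w : EuclideanSpace ℝ (Fin q)) :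
    binomPredictor θ w = ⟪embBinom w, θ⟫ := by
  simp [binomPredictor, muPart, embBinom, PiLp.inner_apply]

lemma continuous_embZero : Continuous (embZero : EuclideanSpace ℝ (Fin p) → Param p q) := by
  refine (PiLp.continuous_toLp 2 _).comp (continuous_pi ?_)
  rintro (j | j) <;> simp only [Sum.elim_inl, Sum.elim_inr] <;> fun_prop

lemma continuous_embBinom : Continuous (embBinom : EuclideanSpace ℝ (Fin q) → Param p q) := by
  refine (PiLp.continuous_toLp 2 _).comp (continuous_pi ?_)
  rintro (j | j) <;> simp only [Sum.elim_inl, Sum.elim_inr] <;> fun_prop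

lemma continuous_predictors :
    Continuous fun z : EuclideanSpace ℝ (Fin p) × EuclideanSpace ℝ (Fin q) × Param p q =>
      (zeroPredictor z.2.2 z.1, binomPredictor z.2.2 z.2.1) := by
  have hx := continuous_embZero (p := p) (q := q)
  have hw := continuous_embBinom (p := p) (q := q)
  simp only [zeroPredictor_eq_inner, binomPredictor_eq_inner]
  fun_prop

lemma continuous_obsScore (m y : ℕ) :
    Continuous fun z : EuclideanSpace ℝ (Fin p) × EuclideanSpace ℝ (Fin q) × Param p q =>
      obsScore m y z.1 z.2.1 z.2.2 := by
  have hx := continuous_embZero (p := p) (q := q)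
  have hw := continuous_embBinom (p := p) (q := q)
  exact (((continuous_relDeriv m y 1 0).comp continuous_predictors).smul (by fun_prop)).add
    (((continuous_relDeriv m y 0 1).comp continuous_predictors).smul (by fun_prop))

lemma continuous_obsHess (m y : ℕ) :
    Continuous fun z : EuclideanSpace ℝ (Fin p) × EuclideanSpace ℝ (Fin q) × Param p q =>
      obsHess m y z.1 z.2.1 z.2.2 := by
  have hu : Continuous fun z : EuclideanSpace ℝ (Fin p) × EuclideanSpace ℝ (Fin q) × Param p q =>
      (embZero z.1 : Param p q).ofLp :=
    (PiLp.continuous_ofLp 2 _).comp (continuous_embZero.comp continuous_fst)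
  have hv : Continuous fun z : EuclideanSpace ℝ (Fin p) × EuclideanSpace ℝ (Fin q) × Param p q =>
      (embBinom z.2.1 : Param p q).ofLp :=
    (PiLp.continuous_ofLp 2 _).comp (continuous_embBinom.comp continuous_snd.fst)
  exact ((((continuous_obsDerivAA m y).comp continuous_predictors).smul
      (hu.matrix_vecMulVec hu)).add
    (((continuous_obsDerivAB m y).comp continuous_predictors).smul
      ((hu.matrix_vecMulVec hv).add (hv.matrix_vecMulVec hu)))).add
    (((continuous_obsDerivBB m y).comp continuous_predictors).smul (hv.matrix_vecMulVec hv))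

lemma isHermitian_obsHess : (obsHess m y x w θ).IsHermitian := by
  ext a b
  simp only [obsHess, conjTranspose_apply, star_trivial, Matrix.add_apply, Matrix.smul_apply,
    vecMulVec_apply, smul_eq_mul]
  ring

lemma toEuclideanCLM_vecMulVec_apply {ι : Type*} [Fintype ι] [DecidableEq ι]
    (u v z : EuclideanSpace ℝ ι) : 𝓛 (vecMulVec u v) z = ⟪v, z⟫ • u := by
  apply WithLp.ofLp_injective 2
  rw [ofLp_toEuclideanCLM, vecMulVec_mulVec]
  simp [EuclideanSpace.inner_eq_star_dotProduct, dotProduct_comm]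

lemma toEuclideanCLM_obsHess_apply (z : Param p q) :
    𝓛 (obsHess m y x w θ) z =
      (obsDerivAA m y (zeroPredictor θ x) (binomPredictor θ w) * zeroPredictor z x +
        obsDerivAB m y (zeroPredictor θ x) (binomPredictor θ w) * binomPredictor z w) •
          embZero x +
      (obsDerivAB m y (zeroPredictor θ x) (binomPredictor θ w) * zeroPredictor z x +
        obsDerivBB m y (zeroPredictor θ x) (binomPredictor θ w) * binomPredictor z w) •
          embBinom w := by
  simp only [obsHess, map_add, map_smul, _root_.add_apply, _root_.smul_apply,
    toEuclideanCLM_vecMulVec_apply, ← zeroPredictor_eq_inner, ← binomPredictor_eq_inner]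
  module

lemma inner_toEuclideanCLM_obsHess (z : Param p q) :
    ⟪z, 𝓛 (obsHess m y x w θ) z⟫ =
      obsDerivAA m y (zeroPredictor θ x) (binomPredictor θ w) * zeroPredictor z x ^ 2 +
      2 * obsDerivAB m y (zeroPredictor θ x) (binomPredictor θ w) * zeroPredictor z x *
        binomPredictor z w +
      obsDerivBB m y (zeroPredictor θ x) (binomPredictor θ w) * binomPredictor z w ^ 2 := by
  rw [toEuclideanCLM_obsHess_apply, inner_add_right, real_inner_smul_right, real_inner_smul_right,
    real_inner_comm, ← zeroPredictor_eq_inner, real_inner_comm, ← binomPredictor_eq_inner]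
  ring

lemma inner_obsScore (z : Param p q) :
    ⟪obsScore m y x w θ, z⟫ =
      relDeriv m y 1 0 (zeroPredictor θ x) (binomPredictor θ w) * zeroPredictor z x +
      relDeriv m y 0 1 (zeroPredictor θ x) (binomPredictor θ w) * binomPredictor z w := by
  rw [obsScore, inner_add_left, real_inner_smul_left, real_inner_smul_left,
    ← zeroPredictor_eq_inner, ← binomPredictor_eq_inner]

lemma HasGrad.hasFDerivAt_predictors {g ga gb : ℝ → ℝ → ℝ} (h : HasGrad g ga gb)
    (x : EuclideanSpace ℝ (Fin p)) (w : EuclideanSpace ℝ (Fin q)) (θ : Param p q) :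
    HasFDerivAt (fun θ : Param p q => g (zeroPredictor θ x) (binomPredictor θ w))
      (ga (zeroPredictor θ x) (binomPredictor θ w) • innerSL ℝ (embZero x) +
        gb (zeroPredictor θ x) (binomPredictor θ w) • innerSL ℝ (embBinom w)) θ := by
  have := h.comp (innerSL ℝ (embZero x : Param p q)) (innerSL ℝ (embBinom w : Param p q)) θ
  simpa only [innerSL_apply_apply, ← zeroPredictor_eq_inner, ← binomPredictor_eq_inner] using this

lemma hasFDerivAt_obsLogLik :
    HasFDerivAt (fun θ : Param p q => obsLogLik m y (zeroPredictor θ x) (binomPredictor θ w))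
      (innerSL ℝ (obsScore m y x w θ)) θ := by
  refine ((hasGrad_obsLogLik m y).hasFDerivAt_predictors x w θ).congr_fderiv ?_
  rw [obsScore, map_add, map_smul, map_smul]

lemma hasFDerivAt_obsScore :
    HasFDerivAt (obsScore m y x w) (𝓛 (obsHess m y x w θ)) θ := by
  have hzero := ((hasGrad_relDeriv_one_zero m y).hasFDerivAt_predictors x w θ).smul_const
    (embZero x : Param p q)
  have hbinom := ((hasGrad_relDeriv_zero_one m y).hasFDerivAt_predictors x w θ).smul_const
    (embBinom w : Param p q)
  refine (hzero.add hbinom).congr_fderiv ?_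
  ext1 z
  rw [toEuclideanCLM_obsHess_apply]
  simp only [_root_.add_apply, ContinuousLinearMap.smulRight_apply, _root_.smul_apply,
    innerSL_apply_apply, ← zeroPredictor_eq_inner, ← binomPredictor_eq_inner, smul_eq_mul]

lemma iteratedDeriv_two_obsLogLik_left (m y : ℕ) (a b : ℝ) :
    iteratedDeriv 2 (fun a => obsLogLik m y a b) a = obsDerivAA m y a b := by
  rw [iteratedDeriv_succ, iteratedDeriv_one,
    funext fun a => ((hasGrad_obsLogLik m y).hasDerivAt_left a b).deriv]
  exact ((hasGrad_relDeriv_one_zero m y).hasDerivAt_left a b).deriv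

lemma iteratedDeriv_two_obsLogLik_right (m y : ℕ) (a b : ℝ) :
    iteratedDeriv 2 (fun b => obsLogLik m y a b) b = obsDerivBB m y a b := by
  rw [iteratedDeriv_succ, iteratedDeriv_one,
    funext fun b => ((hasGrad_obsLogLik m y).hasDerivAt_right a b).deriv]
  exact ((hasGrad_relDeriv_zero_one m y).hasDerivAt_right a b).deriv

lemma deriv_deriv_obsLogLik (m y : ℕ) (a b : ℝ) :
    deriv (fun a => deriv (fun b => obsLogLik m y a b) b) a = obsDerivAB m y a b := by
  rw [funext fun a => ((hasGrad_obsLogLik m y).hasDerivAt_right a b).deriv]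
  exact ((hasGrad_relDeriv_zero_one m y).hasDerivAt_left a b).deriv

end Observation

section ScoreHessian

variable {m y : ℕ → ℕ} {x : ℕ → EuclideanSpace ℝ (Fin p)} {w : ℕ → EuclideanSpace ℝ (Fin q)}
  {n : ℕ} {θ : Param p q}

lemma logLikelihood_eq_sum (hy : ∀ i, y i ≤ m i) (θ : Param p q) :
    logLikelihood m y x w n θ = ∑ i ∈ Finset.range n,
      obsLogLik (m i) (y i) (zeroPredictor θ (x i)) (binomPredictor θ (w i)) := by
  have hne : ∀ i : Fin n, modelProb (m i) θ (x i) (w i) (y i) ≠ 0 :=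
    fun i => (obsProb_pos (hy i) _ _).ne'
  rw [logLikelihood, likelihood, Real.log_prod fun i _ => hne i, Finset.sum_range]
  rfl

lemma hasFDerivAt_logLikelihood (hy : ∀ i, y i ≤ m i) (θ : Param p q) :
    HasFDerivAt (logLikelihood m y x w n)
      (innerSL ℝ (∑ i ∈ Finset.range n, obsScore (m i) (y i) (x i) (w i) θ)) θ := by
  rw [funext (logLikelihood_eq_sum hy), map_sum]
  exact HasFDerivAt.fun_sum fun i _ => hasFDerivAt_obsLogLik

lemma score_eq_sum (hy : ∀ i, y i ≤ m i) (θ : Param p q) :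
    score m y x w n θ = ∑ i ∈ Finset.range n, obsScore (m i) (y i) (x i) (w i) θ :=
  HasGradientAt.gradient <| hasGradientAt_iff_hasFDerivAt.2 (hasFDerivAt_logLikelihood hy θ)

lemma weightMatrix_eq (θ : Param p q) :
    weightMatrix m y x w n θ = fromBlocks
      (diagonal fun i : Fin n => -obsDerivAA (m i) (y i) (zeroPredictor θ (x i))
        (binomPredictor θ (w i)))
      (diagonal fun i : Fin n => -obsDerivAB (m i) (y i) (zeroPredictor θ (x i))
        (binomPredictor θ (w i)))
      (diagonal fun i : Fin n => -obsDerivAB (m i) (y i) (zeroPredictor θ (x i))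
        (binomPredictor θ (w i)))
      (diagonal fun i : Fin n => -obsDerivBB (m i) (y i) (zeroPredictor θ (x i))
        (binomPredictor θ (w i))) := by
  simp only [weightMatrix, iteratedDeriv_two_obsLogLik_left, iteratedDeriv_two_obsLogLik_right,
    deriv_deriv_obsLogLik]

lemma observedInfo_eq_neg_sum (θ : Param p q) :
    observedInfo m y x w n θ = -∑ i ∈ Finset.range n, obsHess (m i) (y i) (x i) (w i) θ := by
  rw [observedInfo, designMatrix, weightMatrix_eq, fromBlocks_transpose, fromBlocks_multiply,
    fromBlocks_multiply]
  ext a b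
  rw [Matrix.neg_apply, Matrix.sum_apply, Finset.sum_range, ← Finset.sum_neg_distrib]
  rcases a with a | a <;> rcases b with b | b <;>
    simp [mul_apply, obsHess, vecMulVec_apply, embZero, embBinom, diagonal_apply, mul_assoc,
      mul_left_comm]

lemma isHermitian_observedInfo : (observedInfo m y x w n θ).IsHermitian := by
  rw [observedInfo_eq_neg_sum, IsHermitian, conjTranspose_neg, conjTranspose_sum]
  exact congrArg _ (Finset.sum_congr rfl fun i _ => isHermitian_obsHess)

lemma hasFDerivAt_sum_obsScore :
    HasFDerivAt (fun θ => ∑ i ∈ Finset.range n, obsScore (m i) (y i) (x i) (w i) θ)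
      (-𝓛 (observedInfo m y x w n θ)) θ := by
  rw [observedInfo_eq_neg_sum, map_neg, neg_neg, map_sum]
  exact HasFDerivAt.fun_sum fun i _ => hasFDerivAt_obsScore

lemma hessian_eq_neg_observedInfo (hy : ∀ i, y i ≤ m i) (θ : Param p q) :
    hessian m y x w n θ = -observedInfo m y x w n θ := by
  have hfderiv : fderiv ℝ (logLikelihood m y x w n) = fun θ =>
      innerSL ℝ (∑ i ∈ Finset.range n, obsScore (m i) (y i) (x i) (w i) θ) :=
    funext fun θ => (hasFDerivAt_logLikelihood hy θ).fderiv
  have hfderiv₂ : HasFDerivAt (fderiv ℝ (logLikelihood m y x w n))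
      ((innerSL ℝ).comp (-𝓛 (observedInfo m y x w n θ))) θ :=
    hfderiv ▸ (innerSL ℝ).hasFDerivAt.comp θ hasFDerivAt_sum_obsScore
  ext a b
  rw [hessian, of_apply, iteratedFDeriv_two_apply, hfderiv₂.fderiv]
  change ⟪-𝓛 (observedInfo m y x w n θ) (EuclideanSpace.single a 1), EuclideanSpace.single b 1⟫ = _
  rw [inner_neg_left, inner_toEuclideanCLM_comm isHermitian_observedInfo, inner_toEuclideanCLM]
  simp

end ScoreHessian

section Compactness

variable {α E : Type*} [SeminormedAddCommGroup E] {f : ℕ → ℕ → α → E} {s : Set α}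

lemma exists_norm_le_of_isCompact [TopologicalSpace α] (hf : ∀ m y, Continuous (f m y))
    (hs : IsCompact s) (M : ℕ) : ∃ C, 0 ≤ C ∧ ∀ m ≤ M, ∀ y ≤ m, ∀ z ∈ s, ‖f m y z‖ ≤ C := by
  have hcont : Continuous fun z => fun m y : Fin (M + 1) => f m y z := by fun_prop
  obtain ⟨C, hC⟩ := hs.exists_bound_of_continuousOn hcont.continuousOn
  refine ⟨max C 0, le_max_right _ _, fun m hm y hy z hz => ?_⟩
  calc ‖f m y z‖ ≤ ‖fun y : Fin (M + 1) => f m y z‖ :=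
        norm_le_pi_norm (fun y : Fin (M + 1) => f m y z) ⟨y, Nat.lt_succ_of_le (hy.trans hm)⟩
    _ ≤ ‖fun m y : Fin (M + 1) => f m y z‖ :=
        norm_le_pi_norm (fun m y : Fin (M + 1) => f m y z) ⟨m, Nat.lt_succ_of_le hm⟩
    _ ≤ max C 0 := (hC z hz).trans (le_max_left _ _)

lemma exists_modulus_of_isCompact [PseudoMetricSpace α] (hf : ∀ m y, Continuous (f m y))
    (hs : IsCompact s) (M : ℕ) {ε : ℝ} (hε : 0 < ε) :
    ∃ δ > 0, ∀ m ≤ M, ∀ y ≤ m, ∀ z ∈ s, ∀ z' ∈ s, dist z z' < δ →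
      dist (f m y z) (f m y z') ≤ ε := by
  have hcont : Continuous fun z => fun m y : Fin (M + 1) => f m y z := by fun_prop
  obtain ⟨δ, hδ, hdist⟩ := Metric.uniformContinuousOn_iff.1
    (hs.uniformContinuousOn_of_continuous hcont.continuousOn) ε hε
  refine ⟨δ, hδ, fun m hm y hy z hz z' hz' hzz' => ?_⟩
  have hm' := (dist_pi_le_iff hε.le).1 (hdist z hz z' hz' hzz').le ⟨m, Nat.lt_succ_of_le hm⟩
  exact (dist_pi_le_iff hε.le).1 hm' ⟨y, Nat.lt_succ_of_le (hy.trans hm)⟩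

end Compactness

section Measurability

variable {α β E : Type*} [MeasurableSpace α] [MeasurableSpace E] [TopologicalSpace E]
  [BorelSpace E] {Y : α → ℕ}

lemma measurable_comp_of_continuous [MeasurableSpace β] [TopologicalSpace β]
    [OpensMeasurableSpace β] {f : ℕ → β → E} (hf : ∀ y, Continuous (f y)) (hY : Measurable Y)
    {Z : α → β} (hZ : Measurable Z) : Measurable fun ω => f (Y ω) (Z ω) :=
  (measurable_from_prod_countable_right (f := fun z : ℕ × β => f z.1 z.2)
    fun y => (hf y).measurable).comp (hY.prodMk hZ)

variable {x : α → EuclideanSpace ℝ (Fin p)} {w : α → EuclideanSpace ℝ (Fin q)}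
  {θ : α → Param p q}

lemma measurable_obsScore (m : ℕ) (hY : Measurable Y) (hx : Measurable x) (hw : Measurable w)
    (hθ : Measurable θ) : Measurable fun ω => obsScore m (Y ω) (x ω) (w ω) (θ ω) := by
  have hZ : Measurable fun ω => (x ω, w ω, θ ω) := hx.prodMk (hw.prodMk hθ)
  simpa only using measurable_comp_of_continuous (continuous_obsScore m) hY hZ

lemma measurable_obsHess_apply (m : ℕ) (hY : Measurable Y) (hx : Measurable x)
    (hw : Measurable w) (hθ : Measurable θ) (a b : Fin p ⊕ Fin q) :
    Measurable fun ω => obsHess m (Y ω) (x ω) (w ω) (θ ω) a b := by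
  have hZ : Measurable fun ω => (x ω, w ω, θ ω) := hx.prodMk (hw.prodMk hθ)
  simpa only using
    measurable_comp_of_continuous (fun y => (continuous_obsHess m y).matrix_elem a b) hY hZ

lemma measurable_observedInfo_apply (m : ℕ → ℕ) {Y : ℕ → α → ℕ}
    {X : ℕ → α → EuclideanSpace ℝ (Fin p)} {W : ℕ → α → EuclideanSpace ℝ (Fin q)}
    (hY : ∀ i, Measurable (Y i)) (hX : ∀ i, Measurable (X i)) (hW : ∀ i, Measurable (W i))
    (hθ : Measurable θ) (n : ℕ) (a b : Fin p ⊕ Fin q) :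
    Measurable fun ω => observedInfo m (Y · ω) (X · ω) (W · ω) n (θ ω) a b := by
  simp only [observedInfo_eq_neg_sum, Matrix.neg_apply, Matrix.sum_apply]
  exact (Finset.measurable_fun_sum _ fun i _ =>
    measurable_obsHess_apply (m i) (hY i) (hX i) (hW i) hθ a b).neg

end Measurability

section Linearization

lemma exists_norm_obsScore_le (θ : Param p q) (M : ℕ) (r : ℝ) :
    ∃ C, ∀ m ≤ M, ∀ y ≤ m, ∀ x w, ‖x‖ ≤ r → ‖w‖ ≤ r → ‖obsScore m y x w θ‖ ≤ C := by
  obtain ⟨C, -, hbound⟩ := exists_norm_le_of_isCompact continuous_obsScore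
    ((isCompact_closedBall (0 : EuclideanSpace ℝ (Fin p)) r).prod
      ((isCompact_closedBall (0 : EuclideanSpace ℝ (Fin q)) r).prod (isCompact_singleton (x := θ))))
    M
  exact ⟨C, fun m hm y hy x w hx hw => hbound m hm y hy (x, w, θ)
    ⟨mem_closedBall_zero_iff.2 hx, mem_closedBall_zero_iff.2 hw, rfl⟩⟩

lemma exists_norm_obsHess_le (θ : Param p q) (M : ℕ) (r : ℝ) :
    ∃ C, ∀ m ≤ M, ∀ y ≤ m, ∀ x w, ‖x‖ ≤ r → ‖w‖ ≤ r → ‖obsHess m y x w θ‖ ≤ C := by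
  obtain ⟨C, -, hbound⟩ := exists_norm_le_of_isCompact continuous_obsHess
    ((isCompact_closedBall (0 : EuclideanSpace ℝ (Fin p)) r).prod
      ((isCompact_closedBall (0 : EuclideanSpace ℝ (Fin q)) r).prod (isCompact_singleton (x := θ))))
    M
  exact ⟨C, fun m hm y hy x w hx hw => hbound m hm y hy (x, w, θ)
    ⟨mem_closedBall_zero_iff.2 hx, mem_closedBall_zero_iff.2 hw, rfl⟩⟩

lemma exists_norm_obsHess_sub_le (θ₀ : Param p q) (M : ℕ) (r : ℝ) {ε : ℝ} (hε : 0 < ε) :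
    ∃ δ > 0, ∀ m ≤ M, ∀ y ≤ m, ∀ x w, ‖x‖ ≤ r → ‖w‖ ≤ r → ∀ θ, ‖θ - θ₀‖ ≤ δ →
      ‖obsHess m y x w θ - obsHess m y x w θ₀‖ ≤ ε := by
  obtain ⟨δ, hδ, hdist⟩ := exists_modulus_of_isCompact continuous_obsHess
    ((isCompact_closedBall (0 : EuclideanSpace ℝ (Fin p)) r).prod
      ((isCompact_closedBall (0 : EuclideanSpace ℝ (Fin q)) r).prod (isCompact_closedBall θ₀ 1)))
    M hε
  refine ⟨min 1 (δ / 2), by positivity, fun m hm y hy x w hx hw θ hθ => ?_⟩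
  have hx' := mem_closedBall_zero_iff.2 hx
  have hw' := mem_closedBall_zero_iff.2 hw
  rw [← dist_eq_norm] at hθ ⊢
  refine hdist m hm y hy (x, w, θ) ⟨hx', hw', hθ.trans (min_le_left _ _)⟩ (x, w, θ₀)
    ⟨hx', hw', Metric.mem_closedBall_self zero_le_one⟩ ?_
  rw [dist_prod_same_left, dist_prod_same_left]
  exact (hθ.trans (min_le_right _ _)).trans_lt (half_lt_self hδ)

lemma norm_sum_obsScore_sub_add_le {m y : ℕ → ℕ} {x : ℕ → EuclideanSpace ℝ (Fin p)}
    {w : ℕ → EuclideanSpace ℝ (Fin q)} {n : ℕ} {θ₀ θ : Param p q} {δ C : ℝ} (hθ : ‖θ - θ₀‖ ≤ δ)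
    (hC : ∀ θ', ‖θ' - θ₀‖ ≤ δ → ‖observedInfo m y x w n θ' - observedInfo m y x w n θ₀‖ ≤ C) :
    ‖∑ i ∈ Finset.range n, obsScore (m i) (y i) (x i) (w i) θ -
        ∑ i ∈ Finset.range n, obsScore (m i) (y i) (x i) (w i) θ₀ +
        𝓛 (observedInfo m y x w n θ) (θ - θ₀)‖ ≤ 2 * C * ‖θ - θ₀‖ := by
  have hδ : 0 ≤ δ := (norm_nonneg _).trans hθ
  have hderiv : ∀ θ' ∈ Metric.closedBall θ₀ δ,
      ‖-𝓛 (observedInfo m y x w n θ') - -𝓛 (observedInfo m y x w n θ)‖ ≤ 2 * C := fun θ' hθ' => by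
    rw [← neg_sub', norm_neg, ← map_sub]
    change ‖observedInfo m y x w n θ' - observedInfo m y x w n θ‖ ≤ 2 * C
    calc _ ≤ ‖observedInfo m y x w n θ' - observedInfo m y x w n θ₀‖ +
          ‖observedInfo m y x w n θ - observedInfo m y x w n θ₀‖ := by
          rw [← sub_sub_sub_cancel_right _ _ (observedInfo m y x w n θ₀)]
          exact norm_sub_le _ _
      _ ≤ 2 * C := by linarith [hC θ' (mem_closedBall_iff_norm.1 hθ'), hC θ hθ]
  have := Convex.norm_image_sub_le_of_norm_hasFDerivWithin_le'
    (fun θ' _ => hasFDerivAt_sum_obsScore.hasFDerivWithinAt) hderiv (convex_closedBall θ₀ δ)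
    (Metric.mem_closedBall_self hδ) (mem_closedBall_iff_norm.2 hθ)
  rwa [_root_.neg_apply, sub_neg_eq_add] at this

lemma exists_delta_linearization (θ₀ : Param p q) (M : ℕ) (r : ℝ) {ε : ℝ} (hε : 0 < ε) :
    ∃ δ > 0, ∀ (m y : ℕ → ℕ) (x : ℕ → EuclideanSpace ℝ (Fin p))
      (w : ℕ → EuclideanSpace ℝ (Fin q)), (∀ i, m i ≤ M) → (∀ i, y i ≤ m i) →
      (∀ i, ‖x i‖ ≤ r ∧ ‖w i‖ ≤ r) → ∀ (n : ℕ) (θ : Param p q), ‖θ - θ₀‖ ≤ δ →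
        ‖observedInfo m y x w n θ - observedInfo m y x w n θ₀‖ ≤ ε * n ∧
        ‖∑ i ∈ Finset.range n, obsScore (m i) (y i) (x i) (w i) θ -
          ∑ i ∈ Finset.range n, obsScore (m i) (y i) (x i) (w i) θ₀ +
          𝓛 (observedInfo m y x w n θ) (θ - θ₀)‖ ≤ ε * n * ‖θ - θ₀‖ := by
  obtain ⟨δ, hδ, hmod⟩ := exists_norm_obsHess_sub_le θ₀ M r (half_pos hε)
  refine ⟨δ, hδ, fun m y x w hm hy hxw n θ hθ => ?_⟩
  have hinfo : ∀ θ : Param p q, ‖θ - θ₀‖ ≤ δ →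
      ‖observedInfo m y x w n θ - observedInfo m y x w n θ₀‖ ≤ ε / 2 * n := fun θ hθ => by
    rw [observedInfo_eq_neg_sum, observedInfo_eq_neg_sum, ← neg_sub', norm_neg,
      ← Finset.sum_sub_distrib]
    refine (norm_sum_le_of_le _ fun i _ =>
      hmod (m i) (hm i) (y i) (hy i) _ _ (hxw i).1 (hxw i).2 θ hθ).trans_eq ?_
    rw [Finset.sum_const, Finset.card_range, nsmul_eq_mul, mul_comm]
  refine ⟨(hinfo θ hθ).trans ?_, (norm_sum_obsScore_sub_add_le hθ hinfo).trans_eq (by ring)⟩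
  gcongr
  exact half_le_self hε.le

end Linearization

section Covariates

lemma modelProb_eq_obsProb (m : ℕ) (θ : Param p q) (x : EuclideanSpace ℝ (Fin p))
    (w : EuclideanSpace ℝ (Fin q)) (y : ℕ) :
    modelProb m θ x w y = obsProb m y (zeroPredictor θ x) (binomPredictor θ w) :=
  rfl

lemma zeroPredictor_single_inl (j : Fin p) (x : EuclideanSpace ℝ (Fin p)) :
    zeroPredictor (EuclideanSpace.single (Sum.inl j) 1 : Param p q) x = x j := by
  simp [zeroPredictor, betaPart]

lemma binomPredictor_single_inl (j : Fin p) (w : EuclideanSpace ℝ (Fin q)) :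
    binomPredictor (EuclideanSpace.single (Sum.inl j) 1 : Param p q) w = 0 := by
  simp [binomPredictor, muPart]

lemma continuous_predictors_left (θ : Param p q) :
    Continuous fun z : EuclideanSpace ℝ (Fin p) × EuclideanSpace ℝ (Fin q) =>
      (zeroPredictor θ z.1, binomPredictor θ z.2) :=
  continuous_predictors.comp
    (by fun_prop : Continuous fun z : EuclideanSpace ℝ (Fin p) × EuclideanSpace ℝ (Fin q) =>
      (z.1, z.2, θ))

lemma continuous_modelProb (m y : ℕ) (θ : Param p q) :
    Continuous fun z : EuclideanSpace ℝ (Fin p) × EuclideanSpace ℝ (Fin q) =>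
      modelProb m θ z.1 z.2 y :=
  (continuous_obsProb m y).comp (continuous_predictors_left θ)

lemma continuous_inner_obsScore (m y : ℕ) (θ u : Param p q) :
    Continuous fun z : EuclideanSpace ℝ (Fin p) × EuclideanSpace ℝ (Fin q) =>
      ⟪obsScore m y z.1 z.2 θ, u⟫ :=
  ((continuous_obsScore m y).comp
    (by fun_prop : Continuous fun z : EuclideanSpace ℝ (Fin p) × EuclideanSpace ℝ (Fin q) =>
      (z.1, z.2, θ))).inner continuous_const

lemma continuous_obsHess_apply (m y : ℕ) (θ : Param p q) (a b : Fin p ⊕ Fin q) :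
    Continuous fun z : EuclideanSpace ℝ (Fin p) × EuclideanSpace ℝ (Fin q) =>
      obsHess m y z.1 z.2 θ a b :=
  ((continuous_obsHess m y).comp
    (by fun_prop : Continuous fun z : EuclideanSpace ℝ (Fin p) × EuclideanSpace ℝ (Fin q) =>
      (z.1, z.2, θ))).matrix_elem a b

lemma continuous_inner_obsHess (m y : ℕ) (θ u : Param p q) :
    Continuous fun z : EuclideanSpace ℝ (Fin p) × EuclideanSpace ℝ (Fin q) =>
      ⟪u, 𝓛 (obsHess m y z.1 z.2 θ) u⟫ := by
  have hentry := continuous_obsHess_apply m y θ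
  simp only [inner_toEuclideanCLM, dotProduct, mulVec]
  fun_prop

end Covariates

section Moments

variable {Ω : Type*} [MeasurableSpace Ω] {P : Measure Ω} {m : ℕ → ℕ} {Y : ℕ → Ω → ℕ}
  {X : ℕ → Ω → EuclideanSpace ℝ (Fin p)} {W : ℕ → Ω → EuclideanSpace ℝ (Fin q)}
  {θ₀ : Param p q} {r : ℝ}

lemma exists_norm_covariates_le [NeZero p] [NeZero q] (hX : RegularCovariates P X)
    (hW : RegularCovariates P W) : ∃ r : ℝ, ∀ᵐ ω ∂P, ∀ i, ‖X i ω‖ ≤ r ∧ ‖W i ω‖ ≤ r := by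
  obtain ⟨G, hG, hXG⟩ := hX.bounded
  obtain ⟨H, hH, hWH⟩ := hW.bounded
  obtain ⟨r, hr⟩ := hG.isBounded.exists_norm_le
  obtain ⟨r', hr'⟩ := hH.isBounded.exists_norm_le
  refine ⟨max r r', ae_all_iff.2 fun i => ?_⟩
  filter_upwards [hXG i, hWH i] with ω hXω hWω
  exact ⟨(hr _ hXω).trans (le_max_left _ _), (hr' _ hWω).trans (le_max_right _ _)⟩

/-- Independent observations from the zero-inflated binomial regression model with probit links,
trial numbers `mᵢ` and true parameter `θ₀`. Unlike in `IsSample`, the covariates of different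
observations may have different distributions, and only those of the zero-inflation component
have the constant `1` as a coordinate. -/
structure IsIndepSample [NeZero p] (P : Measure Ω) (m : ℕ → ℕ) (Y : ℕ → Ω → ℕ)
    (X : ℕ → Ω → EuclideanSpace ℝ (Fin p)) (W : ℕ → Ω → EuclideanSpace ℝ (Fin q))
    (θ₀ : Param p q) : Prop where
  measurable_Y : ∀ i, Measurable (Y i)
  measurable_X : ∀ i, Measurable (X i)
  measurable_W : ∀ i, Measurable (W i)
  intercept_X : ∀ i ω, X i ω 0 = 1
  indep : iIndepFun (fun i ω => (Y i ω, X i ω, W i ω)) P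
  trials_pos : ∀ i, 1 ≤ m i
  trials_bdd : ∃ M, ∀ i, m i ≤ M
  condProb : ∀ i y,
    P⟦Y i ⁻¹' {y} | MeasurableSpace.comap (fun ω => (X i ω, W i ω)) inferInstance⟧
      =ᵐ[P] fun ω => modelProb (m i) θ₀ (X i ω) (W i ω) y

variable [NeZero p]

lemma IsSample.isIndepSample [NeZero q] (h : IsSample P m Y X W θ₀) :
    IsIndepSample P m Y X W θ₀ where
  measurable_Y := h.measurable_Y
  measurable_X := h.measurable_X
  measurable_W := h.measurable_W
  intercept_X := h.intercept_X
  indep := h.indep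
  trials_pos := h.trials_pos
  trials_bdd := h.trials_bdd
  condProb := h.condProb

lemma IsIndepSample.measurable_covariates (h : IsIndepSample P m Y X W θ₀) (i : ℕ) :
    Measurable fun ω => (X i ω, W i ω) :=
  (h.measurable_X i).prodMk (h.measurable_W i)

lemma IsIndepSample.integrable_indicator_mul (h : IsIndepSample P m Y X W θ₀) (i y : ℕ)
    {g : EuclideanSpace ℝ (Fin p) × EuclideanSpace ℝ (Fin q) → ℝ}
    (hint : Integrable (fun ω => g (X i ω, W i ω)) P) :
    Integrable (fun ω => (Y i ⁻¹' {y}).indicator (fun _ => (1 : ℝ)) ω * g (X i ω, W i ω)) P :=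
  (hint.indicator (h.measurable_Y i (measurableSet_singleton y))).congr
    (.of_forall fun ω => by simp [Set.indicator])

variable [IsProbabilityMeasure P]

lemma IsIndepSample.integrable_comp_covariates (h : IsIndepSample P m Y X W θ₀)
    (hr : ∀ᵐ ω ∂P, ∀ i, ‖X i ω‖ ≤ r ∧ ‖W i ω‖ ≤ r) (i : ℕ)
    {g : EuclideanSpace ℝ (Fin p) × EuclideanSpace ℝ (Fin q) → ℝ} (hg : Continuous g) :
    Integrable (fun ω => g (X i ω, W i ω)) P := by
  obtain ⟨C, hC⟩ := ((isCompact_closedBall (0 : EuclideanSpace ℝ (Fin p)) r).prod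
    (isCompact_closedBall (0 : EuclideanSpace ℝ (Fin q)) r)).exists_bound_of_continuousOn
    hg.continuousOn
  refine .of_bound (hg.measurable.comp (h.measurable_covariates i)).aestronglyMeasurable C ?_
  filter_upwards [hr] with ω hω
  exact hC _ ⟨mem_closedBall_zero_iff.2 (hω i).1, mem_closedBall_zero_iff.2 (hω i).2⟩

lemma IsIndepSample.integral_indicator_mul (h : IsIndepSample P m Y X W θ₀) (i y : ℕ)
    {g : EuclideanSpace ℝ (Fin p) × EuclideanSpace ℝ (Fin q) → ℝ} (hg : Measurable g)
    (hint : Integrable (fun ω => g (X i ω, W i ω)) P) :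
    ∫ ω, (Y i ⁻¹' {y}).indicator (fun _ => (1 : ℝ)) ω * g (X i ω, W i ω) ∂P =
      ∫ ω, modelProb (m i) θ₀ (X i ω) (W i ω) y * g (X i ω, W i ω) ∂P := by
  have hind : Integrable ((Y i ⁻¹' {y}).indicator fun _ => (1 : ℝ)) P :=
    (integrable_const _).indicator (h.measurable_Y i (measurableSet_singleton y))
  have hpull := condExp_mul_of_stronglyMeasurable_right
    (hg.comp (comap_measurable fun ω => (X i ω, W i ω))).stronglyMeasurable
    (h.integrable_indicator_mul i y hint) hind
  refine (integral_condExp (h.measurable_covariates i).comap_le).symm.trans (integral_congr_ae ?_)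
  filter_upwards [hpull, h.condProb i y] with ω hpullω hcondω
  exact hpullω.trans (congrArg (· * g (X i ω, W i ω)) hcondω)

lemma IsIndepSample.ae_le_trials (h : IsIndepSample P m Y X W θ₀) :
    ∀ᵐ ω ∂P, ∀ i, Y i ω ≤ m i := by
  refine ae_all_iff.2 fun i => ?_
  have hne : ∀ y, m i < y → ∀ᵐ ω ∂P, Y i ω ≠ y := fun y hy => by
    have hprob := h.integral_indicator_mul i y (g := fun _ => 1) measurable_const
      (integrable_const 1)
    simp only [modelProb_eq_obsProb, obsProb_eq_zero hy, mul_one, integral_zero] at hprob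
    rw [integral_indicator_const _ (h.measurable_Y i (measurableSet_singleton y)), smul_eq_mul,
      mul_one, measureReal_eq_zero_iff] at hprob
    exact measure_eq_zero_iff_ae_notMem.1 hprob
  filter_upwards [ae_all_iff.2 fun y => eventually_imp_distrib_left.2 (hne y)] with ω hω
  exact not_lt.1 fun hlt => hω _ hlt rfl

variable {g : ℕ → EuclideanSpace ℝ (Fin p) × EuclideanSpace ℝ (Fin q) → ℝ}

lemma IsIndepSample.ae_eq_sum_indicator_mul (h : IsIndepSample P m Y X W θ₀) (i : ℕ)
    (g : ℕ → EuclideanSpace ℝ (Fin p) × EuclideanSpace ℝ (Fin q) → ℝ) :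
    (fun ω => g (Y i ω) (X i ω, W i ω)) =ᵐ[P] fun ω => ∑ y ∈ Finset.range (m i + 1),
      (Y i ⁻¹' {y}).indicator (fun _ => (1 : ℝ)) ω * g y (X i ω, W i ω) := by
  filter_upwards [h.ae_le_trials] with ω hω
  rw [Finset.sum_eq_single (Y i ω)]
  · simp
  · intro y _ hy
    simp [Set.indicator, hy.symm]
  · exact fun hmem => absurd (Finset.mem_range_succ_iff.2 (hω i)) hmem

lemma IsIndepSample.integrable_comp (h : IsIndepSample P m Y X W θ₀)
    (hr : ∀ᵐ ω ∂P, ∀ i, ‖X i ω‖ ≤ r ∧ ‖W i ω‖ ≤ r) (i : ℕ) (hg : ∀ y, Continuous (g y)) :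
    Integrable (fun ω => g (Y i ω) (X i ω, W i ω)) P :=
  (integrable_finsetSum _ fun y _ => h.integrable_indicator_mul i y
    (h.integrable_comp_covariates hr i (hg y))).congr (h.ae_eq_sum_indicator_mul i g).symm

lemma IsIndepSample.integral_comp (h : IsIndepSample P m Y X W θ₀)
    (hr : ∀ᵐ ω ∂P, ∀ i, ‖X i ω‖ ≤ r ∧ ‖W i ω‖ ≤ r) (i : ℕ) (hg : ∀ y, Continuous (g y)) :
    ∫ ω, g (Y i ω) (X i ω, W i ω) ∂P = ∫ ω, ∑ y ∈ Finset.range (m i + 1),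
      modelProb (m i) θ₀ (X i ω) (W i ω) y * g y (X i ω, W i ω) ∂P := by
  have hint := fun y => h.integrable_comp_covariates hr i (hg y)
  rw [integral_congr_ae (h.ae_eq_sum_indicator_mul i g), integral_finsetSum, integral_finsetSum]
  · exact Finset.sum_congr rfl fun y _ => h.integral_indicator_mul i y (hg y).measurable (hint y)
  · exact fun y _ => h.integrable_comp_covariates hr i
      (g := fun z => modelProb (m i) θ₀ z.1 z.2 y * g y z)
      ((continuous_modelProb (m i) y θ₀).mul (hg y))
  · exact fun y _ => h.integrable_indicator_mul i y (hint y)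

lemma IsIndepSample.integral_inner_obsScore (h : IsIndepSample P m Y X W θ₀)
    (hr : ∀ᵐ ω ∂P, ∀ i, ‖X i ω‖ ≤ r ∧ ‖W i ω‖ ≤ r) (i : ℕ) (u : Param p q) :
    ∫ ω, ⟪obsScore (m i) (Y i ω) (X i ω) (W i ω) θ₀, u⟫ ∂P = 0 := by
  refine (h.integral_comp hr i fun y => continuous_inner_obsScore (m i) y θ₀ u).trans ?_
  simp only [inner_obsScore, modelProb_eq_obsProb, sum_obsProb_mul_score, integral_zero]

lemma IsIndepSample.integral_inner_obsScore_sq (h : IsIndepSample P m Y X W θ₀)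
    (hr : ∀ᵐ ω ∂P, ∀ i, ‖X i ω‖ ≤ r ∧ ‖W i ω‖ ≤ r) (i : ℕ) (u : Param p q) :
    ∫ ω, ⟪obsScore (m i) (Y i ω) (X i ω) (W i ω) θ₀, u⟫ ^ 2 ∂P =
      -∫ ω, ⟪u, 𝓛 (obsHess (m i) (Y i ω) (X i ω) (W i ω) θ₀) u⟫ ∂P := by
  have hscore : ∀ y, Continuous fun z : EuclideanSpace ℝ (Fin p) × EuclideanSpace ℝ (Fin q) =>
      ⟪obsScore (m i) y z.1 z.2 θ₀, u⟫ ^ 2 :=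
    fun y => (continuous_inner_obsScore (m i) y θ₀ u).pow 2
  have hhess := fun y => continuous_inner_obsHess (m i) y θ₀ u
  rw [eq_neg_iff_add_eq_zero,
    ← integral_add (h.integrable_comp hr i hscore) (h.integrable_comp hr i hhess)]
  refine (h.integral_comp hr i fun y => (hscore y).add (hhess y)).trans ?_
  simp only [inner_obsScore, inner_toEuclideanCLM_obsHess, modelProb_eq_obsProb,
    Pi.add_apply, sum_obsProb_mul_score_sq_add, integral_zero]

end Moments

section Fisher

variable {Ω : Type*} [MeasurableSpace Ω] {P : Measure Ω}

lemma inner_toEuclideanCLM_of_integral {ι : Type*} [Fintype ι] [DecidableEq ι]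
    {A : Ω → Matrix ι ι ℝ} (hA : ∀ a b, Integrable (fun ω => A ω a b) P)
    (u v : EuclideanSpace ℝ ι) :
    ⟪u, 𝓛 (of fun a b => ∫ ω, A ω a b ∂P) v⟫ = ∫ ω, ⟪u, 𝓛 (A ω) v⟫ ∂P := by
  have hterm : ∀ a b, Integrable (fun ω => u a * (A ω a b * v b)) P :=
    fun a b => ((hA a b).mul_const _).const_mul _
  simp only [inner_toEuclideanCLM, dotProduct, mulVec, of_apply, Finset.mul_sum]
  rw [integral_finsetSum _ fun a _ => integrable_finsetSum _ fun b _ => hterm a b]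
  refine Finset.sum_congr rfl fun a _ => ?_
  rw [integral_finsetSum _ fun b _ => hterm a b]
  exact Finset.sum_congr rfl fun b _ => by rw [integral_const_mul, integral_mul_const]

lemma eventually_of_tendstoInMeasure_zero [NeZero P] {f : ℕ → Ω → ℝ} {η : ℝ} {Q : ℕ → Prop}
    (hη : 0 < η) (hf : TendstoInMeasure P f atTop 0)
    (hQ : ∀ᵐ ω ∂P, ∀ᶠ n in atTop, f n ω < η → Q n) : ∀ᶠ n in atTop, Q n := by
  by_contra hcon
  obtain ⟨φ, hφ, hφQ⟩ := extraction_of_frequently_atTop (not_eventually.1 hcon)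
  obtain ⟨ψ, hψ, hψlim⟩ := (hf.comp hφ.tendsto_atTop).exists_seq_tendsto_ae
  obtain ⟨ω, hlim, hQω⟩ := (hψlim.and hQ).exists
  obtain ⟨k, hk, hkQ⟩ := ((hlim.eventually_lt_const (by simpa using hη)).and
    ((hφ.tendsto_atTop.comp hψ.tendsto_atTop).eventually hQω)).exists
  exact hφQ (ψ k) (hkQ hk)

lemma obsProb_mul_relDeriv_sq_pos {m : ℕ} (hm : m ≠ 0) (a b : ℝ) :
    0 < obsProb m 0 a b * relDeriv m 0 1 0 a b ^ 2 := by
  have hprob := obsProb_pos m.zero_le a b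
  have hrel : relDeriv m 0 1 0 a b ≠ 0 := by
    rw [relDeriv, iteratedDeriv_zero]
    exact div_ne_zero
      (mul_ne_zero (iteratedDeriv_one_binomWeight_neg a).ne (binomShift_zero_neg hm b).ne) hprob.ne'
  positivity

lemma exists_pos_le_modelProb_mul_relDeriv_sq (θ : Param p q) (M : ℕ) (r : ℝ) :
    ∃ κ > 0, ∀ m, 1 ≤ m → m ≤ M → ∀ x w, ‖x‖ ≤ r → ‖w‖ ≤ r → κ ≤ modelProb m θ x w 0 *
      relDeriv m 0 1 0 (zeroPredictor θ x) (binomPredictor θ w) ^ 2 := by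
  have hcont : ∀ k, Continuous fun z : EuclideanSpace ℝ (Fin p) × EuclideanSpace ℝ (Fin q) =>
      (modelProb (k + 1) θ z.1 z.2 0 *
        relDeriv (k + 1) 0 1 0 (zeroPredictor θ z.1) (binomPredictor θ z.2) ^ 2)⁻¹ := fun k =>
    ((continuous_modelProb (k + 1) 0 θ).mul (((continuous_relDeriv (k + 1) 0 1 0).comp
      (continuous_predictors_left θ)).pow 2)).inv₀
      fun z => (obsProb_mul_relDeriv_sq_pos k.succ_ne_zero _ _).ne'
  obtain ⟨C, hC, hbound⟩ := exists_norm_le_of_isCompact (fun k _ => hcont k)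
    ((isCompact_closedBall (0 : EuclideanSpace ℝ (Fin p)) r).prod
      (isCompact_closedBall (0 : EuclideanSpace ℝ (Fin q)) r)) M
  refine ⟨(C + 1)⁻¹, by positivity, fun m hm hmM x w hx hw => ?_⟩
  obtain ⟨k, rfl⟩ := Nat.exists_eq_add_of_le' hm
  have hinv := hbound k (by lia) 0 k.zero_le (x, w)
    ⟨mem_closedBall_zero_iff.2 hx, mem_closedBall_zero_iff.2 hw⟩
  exact inv_le_of_inv_le₀ (obsProb_mul_relDeriv_sq_pos k.succ_ne_zero _ _)
    ((le_abs_self _).trans (hinv.trans (le_add_of_nonneg_right zero_le_one)))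

/-- The Fisher information matrix of the first `n` observations: the expectation of the observed
information matrix at `θ₀`. -/
def fisherInfo (P : Measure Ω) (m : ℕ → ℕ) (Y : ℕ → Ω → ℕ)
    (X : ℕ → Ω → EuclideanSpace ℝ (Fin p)) (W : ℕ → Ω → EuclideanSpace ℝ (Fin q))
    (θ₀ : Param p q) (n : ℕ) : Matrix (Fin p ⊕ Fin q) (Fin p ⊕ Fin q) ℝ :=
  -∑ i ∈ Finset.range n, of fun a b => ∫ ω, obsHess (m i) (Y i ω) (X i ω) (W i ω) θ₀ a b ∂P

variable {m : ℕ → ℕ} {Y : ℕ → Ω → ℕ} {X : ℕ → Ω → EuclideanSpace ℝ (Fin p)}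
  {W : ℕ → Ω → EuclideanSpace ℝ (Fin q)} {θ₀ : Param p q} {r : ℝ}

lemma isHermitian_fisherInfo (n : ℕ) : (fisherInfo P m Y X W θ₀ n).IsHermitian := by
  ext a b
  simp only [fisherInfo, conjTranspose_apply, Matrix.neg_apply, Matrix.sum_apply, of_apply,
    star_trivial]
  refine congrArg _ (Finset.sum_congr rfl fun i _ => integral_congr_ae (.of_forall fun ω => ?_))
  exact (isHermitian_obsHess (m := m i)).apply a b

variable [NeZero p] [IsProbabilityMeasure P]

lemma IsIndepSample.ae_norm_obsScore_le (h : IsIndepSample P m Y X W θ₀)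
    (hr : ∀ᵐ ω ∂P, ∀ i, ‖X i ω‖ ≤ r ∧ ‖W i ω‖ ≤ r) :
    ∃ K, ∀ i, ∀ᵐ ω ∂P, ‖obsScore (m i) (Y i ω) (X i ω) (W i ω) θ₀‖ ≤ K := by
  obtain ⟨M, hM⟩ := h.trials_bdd
  obtain ⟨K, hK⟩ := exists_norm_obsScore_le θ₀ M r
  refine ⟨K, fun i => ?_⟩
  filter_upwards [hr, h.ae_le_trials] with ω hXW hY
  exact hK _ (hM i) _ (hY i) _ _ (hXW i).1 (hXW i).2

lemma IsIndepSample.ae_norm_obsHess_le (h : IsIndepSample P m Y X W θ₀)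
    (hr : ∀ᵐ ω ∂P, ∀ i, ‖X i ω‖ ≤ r ∧ ‖W i ω‖ ≤ r) :
    ∃ K, ∀ᵐ ω ∂P, ∀ i, ‖obsHess (m i) (Y i ω) (X i ω) (W i ω) θ₀‖ ≤ K := by
  obtain ⟨M, hM⟩ := h.trials_bdd
  obtain ⟨K, hK⟩ := exists_norm_obsHess_le θ₀ M r
  refine ⟨K, ?_⟩
  filter_upwards [hr, h.ae_le_trials] with ω hXW hY i
  exact hK _ (hM i) _ (hY i) _ _ (hXW i).1 (hXW i).2

lemma IsIndepSample.inner_fisherInfo (h : IsIndepSample P m Y X W θ₀)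
    (hr : ∀ᵐ ω ∂P, ∀ i, ‖X i ω‖ ≤ r ∧ ‖W i ω‖ ≤ r) (n : ℕ) (u : Param p q) :
    ⟪u, 𝓛 (fisherInfo P m Y X W θ₀ n) u⟫ =
      ∑ i ∈ Finset.range n, ∫ ω, ⟪obsScore (m i) (Y i ω) (X i ω) (W i ω) θ₀, u⟫ ^ 2 ∂P := by
  rw [fisherInfo, map_neg, map_sum, _root_.neg_apply, inner_neg_right, _root_.sum_apply, inner_sum,
    ← Finset.sum_neg_distrib]
  refine Finset.sum_congr rfl fun i _ => ?_
  rw [h.integral_inner_obsScore_sq hr, inner_toEuclideanCLM_of_integral fun a b =>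
    h.integrable_comp hr i fun y => continuous_obsHess_apply (m i) y θ₀ a b]

lemma IsIndepSample.exists_le_integral_inner_obsScore_sq (h : IsIndepSample P m Y X W θ₀)
    (hr : ∀ᵐ ω ∂P, ∀ i, ‖X i ω‖ ≤ r ∧ ‖W i ω‖ ≤ r) :
    ∃ κ > 0, ∀ i, κ ≤ ∫ ω, ⟪obsScore (m i) (Y i ω) (X i ω) (W i ω) θ₀,
      EuclideanSpace.single (Sum.inl 0) 1⟫ ^ 2 ∂P := by
  obtain ⟨M, hM⟩ := h.trials_bdd
  obtain ⟨κ, hκ, hle⟩ := exists_pos_le_modelProb_mul_relDeriv_sq θ₀ M r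
  refine ⟨κ, hκ, fun i => ?_⟩
  set e : Param p q := EuclideanSpace.single (Sum.inl 0) 1
  have hsq : ∀ y, Continuous fun z : EuclideanSpace ℝ (Fin p) × EuclideanSpace ℝ (Fin q) =>
      ⟪obsScore (m i) y z.1 z.2 θ₀, e⟫ ^ 2 :=
    fun y => (continuous_inner_obsScore (m i) y θ₀ e).pow 2
  have hsum : Continuous fun z : EuclideanSpace ℝ (Fin p) × EuclideanSpace ℝ (Fin q) =>
      ∑ y ∈ Finset.range (m i + 1),
        modelProb (m i) θ₀ z.1 z.2 y * ⟪obsScore (m i) y z.1 z.2 θ₀, e⟫ ^ 2 :=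
    continuous_finsetSum _ fun y _ => (continuous_modelProb (m i) y θ₀).mul (hsq y)
  have hzero : ∀ᵐ ω ∂P, κ ≤ ∑ y ∈ Finset.range (m i + 1), modelProb (m i) θ₀ (X i ω) (W i ω) y *
      ⟪obsScore (m i) y (X i ω) (W i ω) θ₀, e⟫ ^ 2 := by
    filter_upwards [hr] with ω hω
    refine le_trans ?_ (Finset.single_le_sum (fun y hy => mul_nonneg (obsProb_pos
      (Finset.mem_range_succ_iff.1 hy) _ _).le (sq_nonneg _)) (Finset.mem_range.2 (m i).succ_pos))
    rw [inner_obsScore, zeroPredictor_single_inl, binomPredictor_single_inl, h.intercept_X, mul_one,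
      mul_zero, add_zero]
    exact hle (m i) (h.trials_pos i) (hM i) _ _ (hω i).1 (hω i).2
  calc κ = ∫ _, κ ∂P := by simp
    _ ≤ _ := integral_mono_ae (integrable_const κ) (h.integrable_comp_covariates hr i hsum) hzero
    _ = _ := (h.integral_comp hr i hsq).symm

lemma IsIndepSample.exists_le_inner_fisherInfo (h : IsIndepSample P m Y X W θ₀)
    (hr : ∀ᵐ ω ∂P, ∀ i, ‖X i ω‖ ≤ r ∧ ‖W i ω‖ ≤ r) :
    ∃ κ > 0, ∃ e : Param p q, ‖e‖ = 1 ∧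
      ∀ n : ℕ, κ * n ≤ ⟪e, 𝓛 (fisherInfo P m Y X W θ₀ n) e⟫ := by
  obtain ⟨κ, hκ, hle⟩ := h.exists_le_integral_inner_obsScore_sq hr
  refine ⟨κ, hκ, EuclideanSpace.single (Sum.inl 0) 1, by simp, fun n => ?_⟩
  rw [h.inner_fisherInfo hr]
  simpa [mul_comm] using Finset.card_nsmul_le_sum (Finset.range n) _ κ fun i _ => hle i

lemma IsIndepSample.tendstoInMeasure_observedInfo_sub (h : IsIndepSample P m Y X W θ₀)
    (hr : ∀ᵐ ω ∂P, ∀ i, ‖X i ω‖ ≤ r ∧ ‖W i ω‖ ≤ r) :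
    TendstoInMeasure P (fun n ω => ‖observedInfo m (Y · ω) (X · ω) (W · ω) n θ₀ -
      fisherInfo P m Y X W θ₀ n‖ / n) atTop 0 := by
  obtain ⟨K, hK⟩ := h.ae_norm_obsHess_le hr
  have hentry : ∀ a b, TendstoInMeasure P (fun n ω =>
      (∑ i ∈ Finset.range n, obsHess (m i) (Y i ω) (X i ω) (W i ω) θ₀ a b -
        ∑ i ∈ Finset.range n, ∫ ω, obsHess (m i) (Y i ω) (X i ω) (W i ω) θ₀ a b ∂P) / n)
      atTop 0 := fun a b => by
    refine tendstoInMeasure_sum_sub_integral_div (K := K) (fun i => measurable_obsHess_apply (m i)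
      (h.measurable_Y i) (h.measurable_X i) (h.measurable_W i) measurable_const a b) ?_ fun i => ?_
    · exact h.indep.comp (fun i t => obsHess (m i) t.1 t.2.1 t.2.2 θ₀ a b) fun i =>
        measurable_obsHess_apply (m i) measurable_fst measurable_snd.fst measurable_snd.snd
          measurable_const a b
    · filter_upwards [hK] with ω hω
      exact (abs_apply_le_l2_opNorm _ a b).trans (hω i)
  refine tendstoInMeasure_of_le_sum Finset.univ (g := fun (c : (Fin p ⊕ Fin q) × (Fin p ⊕ Fin q)) n
    ω => (∑ i ∈ Finset.range n, obsHess (m i) (Y i ω) (X i ω) (W i ω) θ₀ c.1 c.2 -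
      ∑ i ∈ Finset.range n, ∫ ω, obsHess (m i) (Y i ω) (X i ω) (W i ω) θ₀ c.1 c.2 ∂P) / n)
    (fun c _ => hentry c.1 c.2) fun n ω => ?_
  rw [abs_of_nonneg (by positivity)]
  simp only [abs_div, Nat.abs_cast, ← Finset.sum_div, Fintype.sum_prod_type]
  gcongr
  refine (l2_opNorm_le_sum _).trans_eq
    (Finset.sum_congr rfl fun a _ => Finset.sum_congr rfl fun b _ => ?_)
  rw [observedInfo_eq_neg_sum, fisherInfo, ← neg_sub', Matrix.neg_apply, abs_neg, Matrix.sub_apply,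
    Matrix.sum_apply, Matrix.sum_apply]
  rfl

lemma IsIndepSample.exists_eventually_le_inner_fisherInfo
    (h : IsIndepSample P m Y X W θ₀) (hr : ∀ᵐ ω ∂P, ∀ i, ‖X i ω‖ ≤ r ∧ ‖W i ω‖ ≤ r)
    (hcond : WellConditioned P m Y X W θ₀) :
    ∃ c > 0, ∀ᶠ n : ℕ in atTop, ∀ u : Param p q,
      c * n * ‖u‖ ^ 2 ≤ ⟪u, 𝓛 (fisherInfo P m Y X W θ₀ n) u⟫ := by
  obtain ⟨κ, hκ, e, he, hle⟩ := h.exists_le_inner_fisherInfo hr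
  obtain ⟨c₂, hc₂, hcond⟩ := hcond
  refine ⟨κ / (4 * c₂), by positivity, eventually_of_tendstoInMeasure_zero
    (η := min (κ / 2) (κ / (4 * c₂))) (by positivity) (h.tendstoInMeasure_observedInfo_sub hr) ?_⟩
  filter_upwards [hcond, h.ae_le_trials] with ω hω hY
  filter_upwards [hω, eventually_gt_atTop 0] with n ⟨hposDef, hratio⟩ hn hdist u
  rw [hessian_eq_neg_observedInfo hY, neg_neg] at hposDef
  have hn₀ : (0 : ℝ) < n := by exact_mod_cast hn
  have hdist' := ((div_lt_iff₀ hn₀).1 hdist).le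
  rw [min_mul_of_nonneg _ _ hn₀.le, div_mul_eq_mul_div, div_mul_eq_mul_div] at hdist'
  rw [div_mul_eq_mul_div]
  exact le_inner_of_maxEigenvalue_div_minEigenvalue_lt hposDef (by positivity) hc₂ hratio he (hle n)
    hdist' u

end Fisher

section Normality

lemma norm_sqrt_apply_sub_le_mul_div_sqrt {ι : Type*} [Fintype ι] [DecidableEq ι]
    {A V : Matrix ι ι ℝ} (hA : A.IsHermitian) (hV : V.PosSemidef) {c C ε N : ℝ} (hc : 0 < c)
    (hN : 0 < N) (hε : ε ≤ c / 4)
    (hV_low : ∀ u : EuclideanSpace ℝ ι, c * N * ‖u‖ ^ 2 ≤ ⟪u, 𝓛 V u⟫)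
    (hAC : ‖A‖ ≤ C * N) (hAV : ‖A - V‖ ≤ ε * N) {h s z : EuclideanSpace ℝ ι}
    (hz : 𝓛 (CFC.sqrt V) z = s) (hs : ‖s - 𝓛 A h‖ ≤ ε * N * ‖h‖) :
    ‖𝓛 (CFC.sqrt A) h - z‖ ≤ 2 / (c * √c) * (√(ε * C) + ε) * (‖s‖ / √N) := by
  have hεN : ε * N ≤ c * N / 4 := by
    rw [mul_div_right_comm]
    gcongr
  have hApos : A.PosSemidef := posSemidef_of_norm_sub_le hA hV_low (by nlinarith)
  refine (norm_sqrt_apply_sub_le hApos hV (by positivity) hεN hV_low hAC hAV hz hs).trans_eq ?_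
  have hsqrt : √(ε * N * (C * N)) = √(ε * C) * N := by
    rw [mul_mul_mul_comm, Real.sqrt_mul' _ (mul_self_nonneg N), Real.sqrt_mul_self hN.le]
  rw [hsqrt, Real.sqrt_mul hc.le]
  field_simp

lemma tendstoInMeasure_zero_of_norm_le_mul {Ω E : Type*} [MeasurableSpace Ω]
    [SeminormedAddCommGroup E] {P : Measure Ω} {f : ℕ → Ω → E} {g : ℕ → Ω → ℝ}
    (hg : ∀ δ > 0, ∃ B > 0, ∀ᶠ n in atTop, P {ω | B ≤ g n ω} ≤ δ)
    (hf : ∀ ρ > 0, Tendsto (fun n => P {ω | ρ * g n ω < ‖f n ω‖}) atTop (𝓝 0)) :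
    TendstoInMeasure P f atTop 0 := by
  refine tendstoInMeasure_iff_norm.2 fun η hη => ENNReal.tendsto_nhds_zero.2 fun δ hδ => ?_
  obtain ⟨B, hB, hgB⟩ := hg (δ / 2) (ENNReal.half_pos hδ.ne')
  filter_upwards [hgB, ENNReal.tendsto_nhds_zero.1 (hf (η / B) (by positivity)) _
    (ENNReal.half_pos hδ.ne')] with n hgn hfn
  have hsubset : {ω | η ≤ ‖f n ω - (0 : Ω → E) ω‖} ⊆
      {ω | η / B * g n ω < ‖f n ω‖} ∪ {ω | B ≤ g n ω} := fun ω hω => by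
    rw [Set.mem_ofPred_eq, Pi.zero_apply, sub_zero] at hω
    rw [Set.mem_union, Set.mem_ofPred_eq, Set.mem_ofPred_eq, or_iff_not_imp_right, not_le]
    intro hgω
    calc η / B * g n ω < η / B * B := by gcongr
      _ = η := div_mul_cancel₀ η hB.ne'
      _ ≤ ‖f n ω‖ := hω
  calc _ ≤ _ := (measure_mono hsubset).trans (measure_union_le _ _)
    _ ≤ δ / 2 + δ / 2 := add_le_add hfn hgn
    _ = δ := ENNReal.add_halves δ

variable {Ω : Type*} [MeasurableSpace Ω] {P : Measure Ω} {m : ℕ → ℕ} {Y : ℕ → Ω → ℕ}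
  {X : ℕ → Ω → EuclideanSpace ℝ (Fin p)} {W : ℕ → Ω → EuclideanSpace ℝ (Fin q)}
  {θ₀ : Param p q} {θhat : ℕ → Ω → Param p q} {r c : ℝ}

/-- The score of the first `n` observations, as the sum of their individual scores. Unlike `score`,
it is measurable in `ω` also where `Yᵢ > mᵢ`. -/
def scoreSum (m : ℕ → ℕ) (Y : ℕ → Ω → ℕ) (X : ℕ → Ω → EuclideanSpace ℝ (Fin p))
    (W : ℕ → Ω → EuclideanSpace ℝ (Fin q)) (n : ℕ) (θ : Param p q) (ω : Ω) : Param p q :=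
  ∑ i ∈ Finset.range n, obsScore (m i) (Y i ω) (X i ω) (W i ω) θ

variable [NeZero p]

lemma IsIndepSample.measurable_normalizedEstimator (h : IsIndepSample P m Y X W θ₀)
    (hθ : ∀ n, Measurable (θhat n)) (n : ℕ) :
    Measurable (normalizedEstimator m Y X W θ₀ θhat n) :=
  measurable_toEuclideanCLM_apply (measurable_sqrt_apply (measurable_observedInfo_apply m
    h.measurable_Y h.measurable_X h.measurable_W (hθ n) n)) ((hθ n).sub_const _)

lemma IsIndepSample.measurable_obsScore (h : IsIndepSample P m Y X W θ₀) (i : ℕ) :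
    Measurable fun ω => obsScore (m i) (Y i ω) (X i ω) (W i ω) θ₀ :=
  ProbitZIB.measurable_obsScore (m i) (h.measurable_Y i) (h.measurable_X i) (h.measurable_W i)
    measurable_const

lemma IsIndepSample.iIndepFun_obsScore (h : IsIndepSample P m Y X W θ₀) :
    iIndepFun (fun i ω => obsScore (m i) (Y i ω) (X i ω) (W i ω) θ₀) P :=
  h.indep.comp (fun i t => obsScore (m i) t.1 t.2.1 t.2.2 θ₀) fun i =>
    ProbitZIB.measurable_obsScore (m i) measurable_fst measurable_snd.fst measurable_snd.snd
      measurable_const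

variable [IsProbabilityMeasure P]

lemma IsIndepSample.tendstoInDistribution_scoreSum (h : IsIndepSample P m Y X W θ₀)
    (hr : ∀ᵐ ω ∂P, ∀ i, ‖X i ω‖ ≤ r ∧ ‖W i ω‖ ≤ r) (hc : 0 < c)
    (hV : ∀ᶠ n : ℕ in atTop, ∀ u : Param p q,
      c * n * ‖u‖ ^ 2 ≤ ⟪u, 𝓛 (fisherInfo P m Y X W θ₀ n) u⟫) :
    TendstoInDistribution
      (fun n ω => 𝓛 (CFC.sqrt (fisherInfo P m Y X W θ₀ n))⁻¹ (scoreSum m Y X W n θ₀ ω)) atTop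
      (fun z : Param p q => z) (fun _ => P) (stdGaussian (Param p q)) := by
  obtain ⟨K, hK⟩ := h.ae_norm_obsScore_le hr
  set R := fun n => (CFC.sqrt (fisherInfo P m Y X W θ₀ n))⁻¹
  have hsymm : ∀ n x y, ⟪𝓛 (R n) x, y⟫ = ⟪x, 𝓛 (R n) y⟫ :=
    fun n => inner_toEuclideanCLM_comm (CFC.sqrt_nonneg _).posSemidef.1.inv
  have hcov : ∀ᶠ n : ℕ in atTop, ∀ u : Param p q,
      ⟪𝓛 (R n) u, 𝓛 (fisherInfo P m Y X W θ₀ n) (𝓛 (R n) u)⟫ = ‖u‖ ^ 2 := by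
    filter_upwards [hV, eventually_gt_atTop 0] with n hVn hn u
    have hposDef := posDef_of_le_inner (isHermitian_fisherInfo n)
      (mul_pos hc (Nat.cast_pos.2 hn)) hVn
    rw [← norm_toEuclideanCLM_sqrt_sq hposDef.posSemidef, toEuclideanCLM_sqrt_inv_apply hposDef]
  refine tendstoInDistribution_clm_sum h.measurable_obsScore h.iIndepFun_obsScore hK
    (h.integral_inner_obsScore hr) hsymm hc ?_ ?_
  · filter_upwards [hV, hcov] with n hVn hcovn u
    exact (hVn _).trans_eq (hcovn u)
  · filter_upwards [hcov] with n hcovn u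
    exact (h.inner_fisherInfo hr n _).symm.trans (hcovn u)

lemma IsIndepSample.exists_measure_norm_scoreSum_ge_le (h : IsIndepSample P m Y X W θ₀)
    (hr : ∀ᵐ ω ∂P, ∀ i, ‖X i ω‖ ≤ r ∧ ‖W i ω‖ ≤ r) {δ : ENNReal} (hδ : 0 < δ) :
    ∃ B > 0, ∀ᶠ n : ℕ in atTop, P {ω | B ≤ ‖scoreSum m Y X W n θ₀ ω‖ / √n} ≤ δ := by
  obtain ⟨K, hK⟩ := h.ae_norm_obsScore_le hr
  have hlim : Tendsto (fun B : ℝ => ENNReal.ofReal (Fintype.card (Fin p ⊕ Fin q) * K ^ 2 / B ^ 2))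
      atTop (𝓝 0) := by
    simpa only [ENNReal.ofReal_zero] using
      ENNReal.tendsto_ofReal ((tendsto_pow_atTop two_ne_zero).const_div_atTop _)
  obtain ⟨B, hB, hBδ⟩ :=
    ((eventually_gt_atTop 0).and (ENNReal.tendsto_nhds_zero.1 hlim δ hδ)).exists
  refine ⟨B, hB, ?_⟩
  filter_upwards [eventually_gt_atTop 0] with n hn
  exact (measure_norm_sum_div_sqrt_ge_le h.measurable_obsScore h.iIndepFun_obsScore hK
    (h.integral_inner_obsScore hr) hn hB).trans hBδ

lemma IsIndepSample.tendsto_measure_scoreSum_ne_zero (h : IsIndepSample P m Y X W θ₀)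
    (hest : IsScoreEstimator P m Y X W θhat) :
    Tendsto (fun n => P {ω | scoreSum m Y X W n (θhat n ω) ω ≠ 0}) atTop (𝓝 0) := by
  rw [← measure_empty (μ := P)]
  refine tendsto_measure_of_ae_tendsto_indicator_of_isFiniteMeasure atTop .empty (fun n => ?_) ?_
  · exact ((Finset.measurable_fun_sum _ fun i _ => ProbitZIB.measurable_obsScore (m i)
      (h.measurable_Y i) (h.measurable_X i) (h.measurable_W i) (hest.measurable n))
      (measurableSet_singleton 0)).compl
  · filter_upwards [h.ae_le_trials, hest.score_eq_zero] with ω hY hscore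
    filter_upwards [hscore] with n hn
    rw [score_eq_sum hY] at hn
    exact iff_of_false (not_not.2 hn) (Set.notMem_empty ω)

lemma exists_pos_mul_sqrt_add_lt (a C : ℝ) {b ρ : ℝ} (hb : 0 < b) (hρ : 0 < ρ) :
    ∃ ε > 0, ε ≤ b ∧ a * (√(ε * C) + ε) ≤ ρ := by
  have hcont : Continuous fun ε : ℝ => a * (√(ε * C) + ε) := by fun_prop
  have hlim := (hcont.tendsto 0).eventually_le_const (by simpa using hρ : _ < ρ)
  obtain ⟨ε, ⟨hle, hεb⟩, hε⟩ := (((hlim.and (eventually_le_nhds hb)).filter_mono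
    nhdsWithin_le_nhds).and (self_mem_nhdsWithin (s := Set.Ioi (0 : ℝ)))).exists
  exact ⟨ε, hε, hεb, hle⟩

lemma IsIndepSample.exists_norm_normalizedEstimator_sub_le (h : IsIndepSample P m Y X W θ₀)
    (hr : ∀ᵐ ω ∂P, ∀ i, ‖X i ω‖ ≤ r ∧ ‖W i ω‖ ≤ r) (hc : 0 < c)
    (hV : ∀ᶠ n : ℕ in atTop, ∀ u : Param p q,
      c * n * ‖u‖ ^ 2 ≤ ⟪u, 𝓛 (fisherInfo P m Y X W θ₀ n) u⟫) {ρ : ℝ} (hρ : 0 < ρ) :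
    ∃ δ > 0, ∃ ε > 0, ∀ᶠ n : ℕ in atTop, ∀ᵐ ω ∂P,
      scoreSum m Y X W n (θhat n ω) ω = 0 → ‖θhat n ω - θ₀‖ < δ →
      ‖observedInfo m (Y · ω) (X · ω) (W · ω) n θ₀ - fisherInfo P m Y X W θ₀ n‖ / n < ε →
      ‖normalizedEstimator m Y X W θ₀ θhat n ω -
        𝓛 (CFC.sqrt (fisherInfo P m Y X W θ₀ n))⁻¹ (scoreSum m Y X W n θ₀ ω)‖ ≤
        ρ * (‖scoreSum m Y X W n θ₀ ω‖ / √n) := by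
  obtain ⟨M, hM⟩ := h.trials_bdd
  obtain ⟨C, hC⟩ := h.ae_norm_obsHess_le hr
  obtain ⟨ε, hε, hεc, hερ⟩ := exists_pos_mul_sqrt_add_lt (2 / (c * √c)) (C + c / 4)
    (by positivity : 0 < c / 4) hρ
  obtain ⟨δ, hδ, hlin⟩ := exists_delta_linearization θ₀ M r (half_pos hε)
  refine ⟨δ, hδ, ε / 2, half_pos hε, ?_⟩
  filter_upwards [hV, eventually_gt_atTop 0] with n hVn hn
  filter_upwards [hr, h.ae_le_trials, hC] with ω hXW hY hCω hroot hnear hlln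
  have hn₀ : (0 : ℝ) < n := by exact_mod_cast hn
  obtain ⟨hinfo, htaylor⟩ := hlin m (Y · ω) (X · ω) (W · ω) hM hY hXW n _ hnear.le
  have hinfo₀ : ‖observedInfo m (Y · ω) (X · ω) (W · ω) n θ₀‖ ≤ C * n := by
    rw [observedInfo_eq_neg_sum, norm_neg]
    simpa [mul_comm] using norm_sum_le_of_le (Finset.range n) fun i _ => hCω i
  set A := observedInfo m (Y · ω) (X · ω) (W · ω) n (θhat n ω)
  have hAV : ‖A - fisherInfo P m Y X W θ₀ n‖ ≤ ε * n := by
    refine (norm_sub_le_norm_sub_add_norm_sub _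
      (observedInfo m (Y · ω) (X · ω) (W · ω) n θ₀) _).trans ?_
    linarith [(div_lt_iff₀ hn₀).1 hlln]
  have hAC : ‖A‖ ≤ (C + c / 4) * n := by
    refine (norm_le_norm_add_norm_sub' A _).trans ((add_le_add hinfo₀ hinfo).trans ?_)
    rw [← add_mul]
    exact mul_le_mul_of_nonneg_right (by linarith) hn₀.le
  have hscore : ‖scoreSum m Y X W n θ₀ ω - 𝓛 A (θhat n ω - θ₀)‖ ≤
      ε * n * ‖θhat n ω - θ₀‖ := by
    rw [← scoreSum, ← scoreSum, hroot, zero_sub, neg_add_eq_sub, norm_sub_rev] at htaylor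
    refine htaylor.trans ?_
    gcongr
    exact half_le_self hε.le
  have hposDef := posDef_of_le_inner (isHermitian_fisherInfo n) (mul_pos hc hn₀) hVn
  refine (norm_sqrt_apply_sub_le_mul_div_sqrt isHermitian_observedInfo hposDef.posSemidef hc
    hn₀ hεc hVn hAC hAV (toEuclideanCLM_sqrt_inv_apply hposDef _) hscore).trans ?_
  gcongr

lemma IsIndepSample.tendstoInMeasure_normalizedEstimator_sub (h : IsIndepSample P m Y X W θ₀)
    (hr : ∀ᵐ ω ∂P, ∀ i, ‖X i ω‖ ≤ r ∧ ‖W i ω‖ ≤ r) (hest : IsScoreEstimator P m Y X W θhat)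
    (hcons : TendstoInMeasure P θhat atTop fun _ => θ₀) (hc : 0 < c)
    (hV : ∀ᶠ n : ℕ in atTop, ∀ u : Param p q,
      c * n * ‖u‖ ^ 2 ≤ ⟪u, 𝓛 (fisherInfo P m Y X W θ₀ n) u⟫) :
    TendstoInMeasure P (normalizedEstimator m Y X W θ₀ θhat - fun n ω =>
      𝓛 (CFC.sqrt (fisherInfo P m Y X W θ₀ n))⁻¹ (scoreSum m Y X W n θ₀ ω)) atTop 0 := by
  refine tendstoInMeasure_zero_of_norm_le_mul
    (fun δ hδ => h.exists_measure_norm_scoreSum_ge_le hr hδ) fun ρ hρ => ?_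
  obtain ⟨δ, hδ, ε, hε, hgood⟩ :=
    h.exists_norm_normalizedEstimator_sub_le (θhat := θhat) hr hc hV hρ
  have hbad := ((h.tendsto_measure_scoreSum_ne_zero hest).add
    (tendstoInMeasure_iff_norm.1 hcons δ hδ)).add
    (tendstoInMeasure_iff_norm.1 (h.tendstoInMeasure_observedInfo_sub hr) ε hε)
  rw [add_zero, add_zero] at hbad
  refine tendsto_of_tendsto_of_tendsto_of_le_of_le' tendsto_const_nhds hbad
    (.of_forall fun _ => zero_le) ?_
  filter_upwards [hgood] with n hn
  refine (measure_mono_ae ?_).trans ((measure_union_le _ _).trans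
    (add_le_add_left (measure_union_le _ _) _))
  filter_upwards [hn] with ω hω (hlarge : _ < _)
  by_contra hcon
  change ω ∉ (_ ∪ _ ∪ _ : Set Ω) at hcon
  simp only [Set.mem_union, Set.mem_ofPred_eq, not_or, not_not, not_le, Pi.zero_apply, sub_zero,
    norm_div, norm_norm, RCLike.norm_natCast] at hcon
  exact hlarge.not_ge (hω hcon.1.1 hcon.1.2 hcon.2)

end Normality

end ProbitZIB

end

theorem theorem2_general {Ω : Type*} [MeasurableSpace Ω] (P : Measure Ω) [IsProbabilityMeasure P]
    {p q : ℕ} [NeZero p] (m : ℕ → ℕ) (Y : ℕ → Ω → ℕ)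
    (X : ℕ → Ω → EuclideanSpace ℝ (Fin p)) (W : ℕ → Ω → EuclideanSpace ℝ (Fin q))
    (θ₀ : ProbitZIB.Param p q) (θhat : ℕ → Ω → ProbitZIB.Param p q)
    (hsample : ProbitZIB.IsIndepSample P m Y X W θ₀)
    {r : ℝ} (hr : ∀ᵐ ω ∂P, ∀ i, ‖X i ω‖ ≤ r ∧ ‖W i ω‖ ≤ r)
    (hcond : ProbitZIB.WellConditioned P m Y X W θ₀)
    (hest : ProbitZIB.IsScoreEstimator P m Y X W θhat)
    (hconsistent : TendstoInMeasure P θhat atTop fun _ => θ₀) :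
    TendstoInDistribution (ProbitZIB.normalizedEstimator m Y X W θ₀ θhat) atTop
      (fun z : ProbitZIB.Param p q => z) (fun _ => P)
      (multivariateGaussian 0 (1 : Matrix (Fin p ⊕ Fin q) (Fin p ⊕ Fin q) ℝ)) := by
  obtain ⟨c, hc, hV⟩ := hsample.exists_eventually_le_inner_fisherInfo hr hcond
  have hclt := tendstoInDistribution_of_tendstoInMeasure_sub
    (ProbitZIB.normalizedEstimator m Y X W θ₀ θhat) _
    (hsample.tendstoInDistribution_scoreSum hr hc hV)
    (hsample.tendstoInMeasure_normalizedEstimator_sub hr hest hconsistent hc hV)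
    fun n => (hsample.measurable_normalizedEstimator hest.measurable n).aemeasurable
  simpa only [multivariateGaussian_zero_one] using hclt

theorem theorem2 {Ω : Type*} [MeasurableSpace Ω] (P : Measure Ω) [IsProbabilityMeasure P]
    {p q : ℕ} [NeZero p] [NeZero q]
    (m : ℕ → ℕ) (Y : ℕ → Ω → ℕ)
    (X : ℕ → Ω → EuclideanSpace ℝ (Fin p)) (W : ℕ → Ω → EuclideanSpace ℝ (Fin q))
    (θ₀ : ProbitZIB.Param p q) (θhat : ℕ → Ω → ProbitZIB.Param p q)
    (hsample : ProbitZIB.IsSample P m Y X W θ₀)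
    (hX : ProbitZIB.RegularCovariates P X) (hW : ProbitZIB.RegularCovariates P W)
    (hθ₀ : ProbitZIB.InteriorParam θ₀)
    (hcond : ProbitZIB.WellConditioned P m Y X W θ₀)
    (hest : ProbitZIB.IsScoreEstimator P m Y X W θhat)
    (hconsistent : ∀ᵐ ω ∂P, Tendsto (fun n => θhat n ω) atTop (𝓝 θ₀)) :
    TendstoInDistribution (ProbitZIB.normalizedEstimator m Y X W θ₀ θhat) atTop
      (fun z : ProbitZIB.Param p q => z) (fun _ => P)
      (multivariateGaussian 0 (1 : Matrix (Fin p ⊕ Fin q) (Fin p ⊕ Fin q) ℝ)) := by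
  obtain ⟨r, hr⟩ := ProbitZIB.exists_norm_covariates_le hX hW
  exact theorem2_general P m Y X W θ₀ θhat hsample.isIndepSample hr hcond hest
    (tendstoInMeasure_of_tendsto_ae (fun n => (hest.measurable n).aestronglyMeasurable) hconsistent)
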